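/- **Theorem 2.6.** Let $f$ be a transcendental (that is, non-rational) meromorphic function in $\mathbb{C}$. With the standard Nevanlinna notation $T(r,\cdot)$, $N(r,\cdot)$, let $S(r,f)$ denote any quantity with $S(r,f)=o(T(r,f))$ as $r\to\infty$, $r\notin E$, where $E\subset(0,\infty)$ is a set of finite Lebesgue measure (which may differ at each occurrence). A *small function* of $f$ is a meromorphic function $b\not\equiv 0,\infty$ in $\mathbb{C}$ with $T(r,b)=S(r,f)$. Let $a$ and $\varphi$ be small functions of $f$, let $k\ge 1$ and $l\ge 1$ be integers, let $q_0,q_1,\dots,q_k$ be non-negative integers with $q_0\ge 1+\frac{2}{l}$ and $q_k\ge 1$, and put $$M[f]=a(z)\,(f)^{q_0}(f')^{q_1}\cdots(f^{(k)})^{q_k}.$$ If every pole of $f$ has multiplicity at least $l$, then $$T(r,f)\le \frac{l}{lq_0-l-1}\,N\left(r,\frac{1}{M[f]-\varphi}\right)+S(r,f).$$ -/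

import Mathlib

open Filter Topology MeasureTheory Asymptotics ValueDistribution

/-- A meromorphic function on `ℂ` is handled as a total function `ℂ → ℂ` that is meromorphic at
every point; two of them are the same meromorphic function when they agree off a closed discrete
set. `SameMeromorphic f g` is this relation. -/
def SameMeromorphic (f g : ℂ → ℂ) : Prop := f =ᶠ[codiscrete ℂ] g

/-- A transcendental meromorphic function in the plane: meromorphic on `ℂ`, and not a rational
function. -/
def TranscendentalMeromorphic (f : ℂ → ℂ) : Prop :=
  Meromorphic f ∧
    ¬ ∃ P Q : Polynomial ℂ, Q ≠ 0 ∧ SameMeromorphic f (fun z => P.eval z / Q.eval z)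

/-- The quantity `s` is an `S(r, f)`: one has `s(r) = o(T(r, f))` as `r → ∞` outside a set `E` of
positive real numbers of finite Lebesgue measure. -/
def IsErrorTerm (f : ℂ → ℂ) (s : ℝ → ℝ) : Prop :=
  ∃ E : Set ℝ, E ⊆ Set.Ioi 0 ∧ MeasurableSet E ∧ volume E < ⊤ ∧
    s =o[atTop ⊓ 𝓟 Eᶜ] characteristic f ⊤

/-- `b` is a small function of `f`: meromorphic on `ℂ`, not identically zero, and with
`T(r, b) = S(r, f)`. -/
def IsSmallFunction (b f : ℂ → ℂ) : Prop :=
  Meromorphic b ∧ ¬ SameMeromorphic b 0 ∧ IsErrorTerm f (characteristic b ⊤)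

/-- The differential monomial `M[f] = a f ^ q₀ (f') ^ q₁ ⋯ (f⁽ᵏ⁾) ^ qₖ`. -/
noncomputable def diffMonomial (a : ℂ → ℂ) (k : ℕ) (q : ℕ → ℕ) (f : ℂ → ℂ) : ℂ → ℂ :=
  fun z => a z * ∏ i ∈ Finset.range (k + 1), (iteratedDeriv i f z) ^ q i

/-- Every pole of `f` has multiplicity at least `l`; a pole of multiplicity `m` is a point at which
`f` has order `-m < 0`. -/
def PolesMultiplicityGe (f : ℂ → ℂ) (l : ℕ) : Prop :=
  ∀ z : ℂ, meromorphicOrderAt f z < 0 → meromorphicOrderAt f z ≤ ((-(l : ℤ) : ℤ) : WithTop ℤ)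

/-! Write `g = M[f]/φ`, `L = g'/(g - 1)`, `d = q₀ + ⋯ + qₖ` and `W = g / f ^ d = (a/φ) ∏ (f⁽ⁱ⁾/f) ^
qᵢ`. The lemma on the logarithmic derivative gives `m(r, W) = S(r, f)`, and `g'/g` and `L` also have
proximity `S(r, f)`, since `T(r, g) = O(T(r, f))` off an exceptional set.

If `g` is not constant, then `f ^ (-d) = W - (g'/g) W / L`. The first main theorem applied to `L`
turns this into `d m(r, 1/f) ≤ N(r, L) - N(r, 1/L) + S(r, f)` (`exists_proximity_inv_le`).

The right side is controlled point by point. At a zero of `f` of order `p`, `g` vanishes to order at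
least `q₀ p`, up to the orders of `a` and `φ`, and where `g` vanishes `L` vanishes to one order
less. At a pole of `f`, `L` has at most a simple pole, while the pole of `f` counts at least `l`
times. The remaining poles of `L` are paid for by zeros of `M[f] - φ` or by zeros and poles of `a`
and `φ`. Hence `(q₀ - 1) N(r, 1/f) + N(r, L) - N(r, 1/L) ≤ N(r, f)/l + N(r, 1/(M[f] - φ)) + S(r, f)`
(`logCounting_logDeriv_inequality`). With `T(r, f) = T(r, 1/f) + O(1)`, the two estimates give `(q₀
- 1 - 1/l) T(r, f) ≤ N(r, 1/(M[f] - φ)) + S(r, f)`.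

If `g` is constant, the same quotient `W` shows that `T(r, f)` is itself an error term.

The supporting theory is the lemma on the logarithmic derivative, obtained from the Poisson formula
and Borel's growth lemma, and the fact that `log r = o(T(r, f))` for transcendental `f`. -/

/-! ### Poisson formula for zero-free functions. -/

/-- For a zero-free analytic function on a closed disk, the Poisson integral formula bounds the
logarithmic derivative by the mean of `|log ‖g‖|` on the boundary circle. -/
theorem norm_logDeriv_le_circleAverage {g : ℂ → ℂ} {R : ℝ} {w : ℂ}
    (hg : AnalyticOnNhd ℂ g (Metric.closedBall 0 R))
    (hg0 : ∀ z ∈ Metric.closedBall (0 : ℂ) R, g z ≠ 0) (hw : w ∈ Metric.ball (0 : ℂ) R) :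
    ‖logDeriv g w‖ ≤
      2 * R / (R - ‖w‖) ^ 2 * Real.circleAverage (fun z => |Real.log ‖g z‖|) 0 R := by
  have hR : 0 < R := Metric.pos_of_mem_ball hw
  have hRabs : |R| = R := abs_of_pos hR
  have hw' : ‖w‖ < R := by simpa using hw
  set u : ℂ → ℝ := fun z => Real.log ‖g z‖ with hu
  have hharm : InnerProductSpace.HarmonicOnNhd u (Metric.closedBall 0 R) := fun z hz =>
    (hg z hz).harmonicAt_log_norm (hg0 z hz)
  have hucont : ContinuousOn u (Metric.sphere 0 |R|) := by
    rw [hRabs]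
    exact hharm.continuousOn.mono Metric.sphere_subset_closedBall
  have huint : CircleIntegrable u 0 R := hucont.circleIntegrable'
  have huint' : CircleIntegrable (fun z => (u z : ℂ)) 0 R :=
    ContinuousOn.circleIntegrable' (Complex.continuous_ofReal.comp_continuousOn hucont)
  set H : ℂ → ℂ := fun w => Real.circleAverage (fun ζ => herglotzRieszKernel 0 w ζ • (u ζ : ℂ)) 0 R
    with hH
  have hHderiv : ∀ z ∈ Metric.ball (0 : ℂ) R, HasDerivAt H
      (Real.circleAverage (fun ζ => (2 * ζ / (ζ - z) ^ 2) • (u ζ : ℂ)) 0 R) z := fun z hz =>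
    hasDerivAt_circleAverage_herglotzRieszKernel_smul huint' hz
  have hHre : ∀ z ∈ Metric.ball (0 : ℂ) R, (H z).re = u z := fun z hz => by
    rw [hH, re_circleAverage_herglotzRieszKernel_smul huint hz]
    exact hharm.circleAverage_re_herglotzRieszKernel_smul hz
  -- Since `Re H = log ‖g‖`, the function `exp (-H) g` has modulus one, so it is constant by the
  -- maximum principle and `g'/g = H'`. The bound then comes from the differentiated kernel `2ζ / (ζ
  -- - w) ^ 2`.
  set k : ℂ → ℂ := fun z => Complex.exp (-H z) * g z with hk
  have hkderiv : ∀ z ∈ Metric.ball (0 : ℂ) R, HasDerivAt k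
      (Complex.exp (-H z) * (-deriv H z) * g z + Complex.exp (-H z) * deriv g z) z := by
    intro z hz
    have h1 := (hHderiv z hz).differentiableAt.hasDerivAt
    exact h1.fun_neg.cexp.mul
      (hg z (Metric.ball_subset_closedBall hz)).differentiableAt.hasDerivAt
  have hknorm : ∀ z ∈ Metric.ball (0 : ℂ) R, ‖k z‖ = 1 := by
    intro z hz
    have hgz := norm_pos_iff.2 (hg0 z (Metric.ball_subset_closedBall hz))
    rw [hk]
    simp only [norm_mul, Complex.norm_exp, Complex.neg_re, hHre z hz, hu, Real.exp_neg,
      Real.exp_log hgz]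
    exact inv_mul_cancel₀ hgz.ne'
  have hconst : Set.EqOn k (Function.const ℂ (k w)) (Metric.ball 0 R) := by
    refine Complex.eqOn_of_isPreconnected_of_isMaxOn_norm
      (convex_ball (0 : ℂ) R).isPreconnected Metric.isOpen_ball
      (fun z hz => (hkderiv z hz).differentiableAt.differentiableWithinAt) hw ?_
    intro z hz
    simp [hknorm z hz, hknorm w hw]
  have hk0 : deriv k w = 0 := by
    have : k =ᶠ[𝓝 w] Function.const ℂ (k w) :=
      hconst.eventuallyEq_of_mem (Metric.isOpen_ball.mem_nhds hw)
    rw [this.deriv_eq]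
    exact deriv_const w _
  have hlog : logDeriv g w = deriv H w := by
    rw [(hkderiv w hw).deriv] at hk0
    have hgw := hg0 w (Metric.ball_subset_closedBall hw)
    have : Complex.exp (-H w) * (deriv g w - deriv H w * g w) = 0 := by rw [← hk0]; ring
    have := (mul_eq_zero.1 this).resolve_left (Complex.exp_ne_zero _)
    rw [logDeriv_apply, div_eq_iff hgw]
    exact sub_eq_zero.1 this
  rw [hlog, (hHderiv w hw).deriv, Real.circleAverage_def, Real.circleAverage_def, norm_smul,
    smul_eq_mul, Real.norm_of_nonneg (by positivity), mul_left_comm]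
  refine mul_le_mul_of_nonneg_left ?_ (by positivity)
  rw [← intervalIntegral.integral_const_mul]
  refine intervalIntegral.norm_integral_le_of_norm_le Real.two_pi_pos.le ?_ ?_
  · refine Eventually.of_forall fun θ _ => ?_
    have hd : R - ‖w‖ ≤ ‖circleMap 0 R θ - w‖ := by
      have := norm_sub_norm_le (circleMap 0 R θ) w
      rwa [norm_circleMap_zero, hRabs] at this
    have hpos : 0 < R - ‖w‖ := sub_pos.2 hw'
    rw [norm_smul, norm_div, norm_mul, norm_pow, norm_circleMap_zero, hRabs, Complex.norm_real,
      Real.norm_eq_abs]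
    simp only [Complex.norm_ofNat]
    gcongr
  · have : CircleIntegrable (fun z => |u z|) 0 R := huint.abs
    exact IntervalIntegrable.const_mul this _

/-! ### Circle means of `|log ‖z - u‖|` and of `‖z - u‖ ^ (-1/2)`. -/

/-- If `x ≤ B` and `0 ≤ B`, then `|x| ≤ 2B - x`. Take `x = log ‖z - u‖` and `B = log (2R)`; by
Jensen's formula the mean of `x` is `log R ≥ 0`. -/
theorem circleAverage_abs_log_norm_sub_le {R : ℝ} (hR : 1 ≤ R) {u : ℂ}
    (hu : u ∈ Metric.closedBall (0 : ℂ) R) :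
    Real.circleAverage (fun z => |Real.log ‖z - u‖|) 0 R ≤ 2 * Real.log (2 * R) := by
  have hRabs : |R| = R := abs_of_pos (by linarith)
  have h1 : CircleIntegrable (fun z => Real.log ‖z - u‖) 0 R :=
    circleIntegrable_log_norm_sub_const R
  have h2 := circleAverage_log_norm_sub_const_of_mem_closedBall (a := u) (c := 0) (R := R)
    (by rwa [hRabs])
  have hlogR : 0 ≤ Real.log R := Real.log_nonneg hR
  have hlog2R : 0 ≤ Real.log (2 * R) := Real.log_nonneg (by linarith)
  have h3 : Real.circleAverage (fun z => |Real.log ‖z - u‖|) 0 R ≤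
      Real.circleAverage (fun z => 2 * Real.log (2 * R) - Real.log ‖z - u‖) 0 R := by
    refine Real.circleAverage_mono h1.abs ((circleIntegrable_const _ _ _).sub h1) ?_
    intro z hz
    have hz' : ‖z‖ = R := by simpa [hRabs] using hz
    have hu' : ‖u‖ ≤ R := by simpa using hu
    have hle : Real.log ‖z - u‖ ≤ Real.log (2 * R) := by
      rcases eq_or_ne ‖z - u‖ 0 with h | h
      · rw [h, Real.log_zero]; exact hlog2R
      · refine Real.log_le_log (lt_of_le_of_ne (norm_nonneg _) h.symm) ?_
        linarith [norm_sub_le z u]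
    rw [abs_le]
    constructor <;> linarith
  rw [Real.circleAverage_fun_sub (circleIntegrable_const _ _ _) h1, h2,
    Real.circleAverage_const] at h3
  linarith

/-- Jordan's inequality `sin θ ≥ 2θ/π` compares the singularity at zero with `θ ^ (-1/2)`;
reflection and periodicity do the rest. -/
theorem intervalIntegrable_inv_sqrt_abs_sin (a b : ℝ) :
    IntervalIntegrable (fun θ => (√|Real.sin θ|)⁻¹) volume a b := by
  have hper : Function.Periodic (fun θ => (√|Real.sin θ|)⁻¹) Real.pi := fun θ => by
    simp [Real.sin_add_pi]
  have hmeas : Measurable (fun θ => (√|Real.sin θ|)⁻¹) := by fun_prop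
  have hhalf : IntervalIntegrable (fun θ => (√|Real.sin θ|)⁻¹) volume 0 (Real.pi / 2) := by
    refine ((intervalIntegral.intervalIntegrable_rpow' (a := 0) (b := Real.pi / 2)
      (r := -(1 / 2)) (by norm_num)).const_mul (√(2 / Real.pi))⁻¹).mono_fun
      hmeas.aestronglyMeasurable ?_
    refine (ae_restrict_iff' measurableSet_uIoc).2 (Eventually.of_forall fun θ hθ => ?_)
    rw [Set.uIoc_of_le (by positivity)] at hθ
    have h1 := Real.mul_le_sin hθ.1.le hθ.2
    have h0 : 0 < 2 / Real.pi * θ := mul_pos (by positivity) hθ.1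
    beta_reduce
    rw [norm_mul, Real.norm_of_nonneg (by positivity), Real.norm_of_nonneg (by positivity),
      Real.norm_of_nonneg (Real.rpow_nonneg hθ.1.le _), Real.rpow_neg hθ.1.le,
      ← Real.sqrt_eq_rpow, ← mul_inv, ← Real.sqrt_mul (by positivity)]
    rw [abs_of_pos (h0.trans_le h1)]
    gcongr
  have hhalf' : IntervalIntegrable (fun θ => (√|Real.sin θ|)⁻¹) volume (Real.pi / 2) Real.pi := by
    have := hhalf.comp_sub_left Real.pi
    simp only [Real.sin_pi_sub] at this
    convert this.symm using 1 <;> ring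
  refine hper.intervalIntegrable Real.pi_ne_zero (t := 0) ?_ a b
  rw [zero_add]
  exact hhalf.trans hhalf'

/-- Rotating by `-arg u` makes `u` a nonnegative real, and the left side is then the modulus of the
imaginary part of the difference. The bound depends on `u` only through a shift of `θ`, which gives
uniformity in `u`. -/
theorem mul_abs_sin_le_norm_circleMap_sub {r : ℝ} (hr : 0 ≤ r) (u : ℂ) (θ : ℝ) :
    r * |Real.sin (θ - u.arg)| ≤ ‖circleMap 0 r θ - u‖ := by
  have h1 : ‖circleMap 0 r θ - u‖ =
      ‖(circleMap 0 r θ - u) * Complex.exp ((-u.arg : ℝ) * Complex.I)‖ := by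
    rw [norm_mul, Complex.norm_exp_ofReal_mul_I, mul_one]
  have h2 : (circleMap 0 r θ - u) * Complex.exp ((-u.arg : ℝ) * Complex.I) =
      r * Complex.exp ((θ - u.arg : ℝ) * Complex.I) - (‖u‖ : ℝ) := by
    have hu : u * Complex.exp ((-u.arg : ℝ) * Complex.I) = (‖u‖ : ℝ) := by
      nth_rewrite 1 [← Complex.norm_mul_exp_arg_mul_I u]
      rw [mul_assoc, ← Complex.exp_add]
      simp
    rw [sub_mul, hu, circleMap, zero_add, mul_assoc, ← Complex.exp_add]
    congr 3
    push_cast; ring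
  have h3 : ((r : ℂ) * Complex.exp ((θ - u.arg : ℝ) * Complex.I) - (‖u‖ : ℝ)).im =
      r * Real.sin (θ - u.arg) := by
    rw [Complex.sub_im, Complex.ofReal_im, sub_zero, Complex.im_ofReal_mul,
      Complex.exp_ofReal_mul_I_im]
  rw [h1, h2]
  refine le_trans (le_of_eq ?_) (Complex.abs_im_le_norm _)
  rw [h3, abs_mul, abs_of_nonneg hr]

/-- The mean of `‖z - u‖ ^ (-1/2)` on a circle of radius at least one about the origin is bounded
uniformly in `u` and in the radius. -/
theorem exists_circleAverage_inv_sqrt_norm_sub_le :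
    ∃ K : ℝ, 0 ≤ K ∧ ∀ r : ℝ, 1 ≤ r → ∀ u : ℂ,
      CircleIntegrable (fun z => (√‖z - u‖)⁻¹) 0 r ∧
        Real.circleAverage (fun z => (√‖z - u‖)⁻¹) 0 r ≤ K := by
  refine ⟨(2 * Real.pi)⁻¹ * ∫ θ in (0 : ℝ)..(2 * Real.pi), (√|Real.sin θ|)⁻¹, ?_, ?_⟩
  · exact mul_nonneg (by positivity) (intervalIntegral.integral_nonneg (by positivity)
      fun _ _ => by positivity)
  intro r hr u
  have hshift : IntervalIntegrable (fun θ => (√|Real.sin (θ - u.arg)|)⁻¹) volume 0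
      (2 * Real.pi) := by
    simpa using (intervalIntegrable_inv_sqrt_abs_sin (0 - u.arg) (2 * Real.pi - u.arg)).comp_sub_right
      u.arg
  have hzero : ∀ᵐ θ : ℝ, Real.sin (θ - u.arg) ≠ 0 := by
    have : {θ : ℝ | ¬ Real.sin (θ - u.arg) ≠ 0} ⊆
        Set.range fun n : ℤ => n * Real.pi + u.arg := by
      intro θ hθ
      obtain ⟨n, hn⟩ := Real.sin_eq_zero_iff.1 (not_not.1 hθ)
      exact ⟨n, by simp only [hn]; ring⟩
    exact ((Set.countable_range _).mono this).measure_zero _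
  have hle : ∀ᵐ θ : ℝ, (√‖circleMap 0 r θ - u‖)⁻¹ ≤ (√|Real.sin (θ - u.arg)|)⁻¹ := by
    filter_upwards [hzero] with θ hθ
    have h1 := mul_abs_sin_le_norm_circleMap_sub (by linarith : (0 : ℝ) ≤ r) u θ
    have h2 : 0 < |Real.sin (θ - u.arg)| := abs_pos.2 hθ
    have h3 : |Real.sin (θ - u.arg)| ≤ ‖circleMap 0 r θ - u‖ :=
      le_trans (le_mul_of_one_le_left h2.le hr) h1
    gcongr
  have hint : IntervalIntegrable (fun θ => (√‖circleMap 0 r θ - u‖)⁻¹) volume 0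
      (2 * Real.pi) := by
    refine hshift.mono_fun (by fun_prop) (ae_restrict_of_ae ?_)
    filter_upwards [hle] with θ hθ
    rwa [Real.norm_of_nonneg (by positivity), Real.norm_of_nonneg (by positivity)]
  refine ⟨hint, ?_⟩
  rw [Real.circleAverage_def, smul_eq_mul]
  refine mul_le_mul_of_nonneg_left ?_ (by positivity)
  refine (intervalIntegral.integral_mono_ae Real.two_pi_pos.le hint hshift hle).trans (le_of_eq ?_)
  have hper : Function.Periodic (fun θ => (√|Real.sin θ|)⁻¹) (2 * Real.pi) := fun θ => by simp
  have := hper.intervalIntegral_add_eq (0 - u.arg) 0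
  rw [zero_add] at this
  rw [intervalIntegral.integral_comp_sub_right (fun θ => (√|Real.sin θ|)⁻¹) u.arg, ← this]
  congr 1
  ring

/-! ### Counting zeros and poles in a disk. -/

/-- A point `u` of the divisor contributes `D u * log (ρ / ‖u‖)` to the counting function, and `‖u‖
≤ R`; dropping the points outside `S` only lowers the count. -/
theorem sum_mul_log_sub_le_logCounting {D : Function.locallyFinsupp ℂ ℤ} (hD : 0 ≤ D)
    {S : Finset ℂ} {R ρ : ℝ} (hR : 1 ≤ R) (hρ : R ≤ ρ) (hS : ∀ u ∈ S, ‖u‖ ≤ R) :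
    (∑ u ∈ S, (D u : ℝ)) * (Real.log ρ - Real.log R) ≤
      Function.locallyFinsuppWithin.logCounting D ρ := by
  classical
  set E : Function.locallyFinsupp ℂ ℤ :=
    ∑ u ∈ S, Function.locallyFinsuppWithin.single u (D u) with hE
  have hED : E ≤ D := by
    intro z
    have h0 : 0 ≤ D z := hD z
    have : E z = ∑ u ∈ S, if z = u then D u else 0 := by
      rw [hE, Function.locallyFinsuppWithin.coe_sum, Finset.sum_apply]
      refine Finset.sum_congr rfl fun u _ => ?_
      rw [Function.locallyFinsuppWithin.single_apply]
    rw [this, Finset.sum_ite_eq]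
    split_ifs <;> simp [h0]
  have hsum : Function.locallyFinsuppWithin.logCounting E ρ =
      ∑ u ∈ S, (D u : ℝ) * (Real.log ρ - Real.log ‖u‖) := by
    rw [hE, map_sum, Finset.sum_apply]
    exact Finset.sum_congr rfl fun u hu =>
      Function.locallyFinsuppWithin.logCounting_single_eq_log_sub_const ((hS u hu).trans hρ)
  refine le_trans ?_ (Function.locallyFinsuppWithin.logCounting_le hED (hR.trans hρ))
  rw [hsum, Finset.sum_mul]
  refine Finset.sum_le_sum fun u hu => ?_
  have h0 : (0 : ℝ) ≤ D u := by exact_mod_cast hD u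
  have hlog : Real.log ‖u‖ ≤ Real.log R := by
    -- The origin contributes `D 0 * log ρ`, which agrees with the convention `log 0 = 0`; this case
    -- is where `1 ≤ R` matters.
    rcases eq_or_ne u 0 with rfl | h
    · simpa using Real.log_nonneg hR
    · exact Real.log_le_log (norm_pos_iff.2 h) (hS u hu)
  gcongr

/-- The number of zeros and poles in a disk is controlled by the counting functions. -/
theorem sum_abs_divisor_mul_log_sub_le {h : ℂ → ℂ} {S : Finset ℂ} {R ρ : ℝ}
    (hR : 1 ≤ R) (hρ : R ≤ ρ) (hS : ∀ u ∈ S, ‖u‖ ≤ R) :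
    (∑ u ∈ S, |(MeromorphicOn.divisor h Set.univ u : ℝ)|) * (Real.log ρ - Real.log R) ≤
      logCounting h ⊤ ρ + logCounting h 0 ρ := by
  have h1 := sum_mul_log_sub_le_logCounting (negPart_nonneg (MeromorphicOn.divisor h Set.univ))
    hR hρ hS
  have h2 := sum_mul_log_sub_le_logCounting (posPart_nonneg (MeromorphicOn.divisor h Set.univ))
    hR hρ hS
  rw [logCounting_top, logCounting_zero]
  refine le_trans (le_of_eq ?_) (add_le_add h1 h2)
  rw [← add_mul, ← Finset.sum_add_distrib]
  congr 1
  refine Finset.sum_congr rfl fun u _ => ?_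
  have : |MeromorphicOn.divisor h Set.univ u| = (MeromorphicOn.divisor h Set.univ)⁻ u +
      (MeromorphicOn.divisor h Set.univ)⁺ u := by
    rw [Function.locallyFinsuppWithin.negPart_apply, Function.locallyFinsuppWithin.posPart_apply,
      add_comm]
    exact (posPart_add_negPart _).symm
  exact_mod_cast this

/-- This integrates `|log x| = log⁺ x + log⁺ (1/x)`. -/
theorem circleAverage_abs_log_norm_eq {h : ℂ → ℂ} (hh : Meromorphic h) (R : ℝ) :
    Real.circleAverage (fun z => |Real.log ‖h z‖|) 0 R = proximity h ⊤ R + proximity h⁻¹ ⊤ R := by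
  rw [proximity_top, proximity_top, ← Real.circleAverage_add
    hh.meromorphicOn.circleIntegrable_posLog_norm
    hh.inv.meromorphicOn.circleIntegrable_posLog_norm]
  congr 1
  ext z
  simp only [Pi.add_apply, Pi.inv_apply, norm_inv]
  rw [Real.posLog_apply, Real.posLog_apply, Real.log_inv]
  rcases le_total 0 (Real.log ‖h z‖) with h1 | h1
  · rw [abs_of_nonneg h1, max_eq_right h1, max_eq_left (by linarith), add_zero]
  · rw [abs_of_nonpos h1, max_eq_left h1, max_eq_right (by linarith), zero_add]

/-- Jensen's inequality for the concave logarithm, in the form of its tangent line at `1 + B`, after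
`log⁺ x ≤ 2 log (1 + √x)`. The square root lets the majorant `b` have singularities of type `‖z - u‖
^ (-1/2)`. -/
theorem circleAverage_posLog_le {F : ℂ → ℂ} {b : ℂ → ℝ} {r B : ℝ}
    (hF : CircleIntegrable (fun z => Real.posLog ‖F z‖) 0 r) (hb : CircleIntegrable b 0 r)
    (hFb : ∀ z ∈ Metric.sphere (0 : ℂ) |r|, √‖F z‖ ≤ b z) (hB : Real.circleAverage b 0 r ≤ B) (hB0 : 0 ≤ B) :
    Real.circleAverage (fun z => Real.posLog ‖F z‖) 0 r ≤ 2 * Real.log (1 + B) := by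
  have hB1 : 0 < 1 + B := by linarith
  have hle : ∀ z ∈ Metric.sphere (0 : ℂ) |r|, Real.posLog ‖F z‖ ≤ 2 * ((1 + B)⁻¹ * b z) +
      2 * (Real.log (1 + B) + (1 + B)⁻¹ - 1) := by
    intro z hz
    have hs : 0 ≤ √‖F z‖ := Real.sqrt_nonneg _
    have h1 : Real.posLog ‖F z‖ ≤ 2 * Real.log (1 + √‖F z‖) := by
      have h2 : ‖F z‖ ≤ (1 + √‖F z‖) ^ 2 := by
        nlinarith [Real.sq_sqrt (norm_nonneg (F z))]
      have h3 : Real.posLog ‖F z‖ ≤ Real.posLog ((1 + √‖F z‖) ^ 2) :=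
        Real.posLog_le_posLog (norm_nonneg _) h2
      have h4 : 1 ≤ |(1 + √‖F z‖) ^ 2| := by
        rw [abs_of_nonneg (by positivity)]
        nlinarith
      rw [Real.posLog_eq_log h4, Real.log_pow] at h3
      exact_mod_cast h3
    have h4 : Real.log (1 + √‖F z‖) ≤
        Real.log (1 + B) + (1 + √‖F z‖) / (1 + B) - 1 := by
      have := Real.log_le_sub_one_of_pos (x := (1 + √‖F z‖) / (1 + B)) (by positivity)
      rw [Real.log_div (by positivity) hB1.ne'] at this
      linarith
    have h5 : (1 + √‖F z‖) / (1 + B) ≤ (1 + b z) / (1 + B) := by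
      have := hFb z hz
      gcongr
    have h6 : (1 + b z) / (1 + B) = (1 + B)⁻¹ + (1 + B)⁻¹ * b z := by
      field_simp
    linarith
  have hbi : CircleIntegrable (fun z => 2 * ((1 + B)⁻¹ * b z)) 0 r :=
    IntervalIntegrable.const_mul (IntervalIntegrable.const_mul hb _) _
  refine (Real.circleAverage_mono hF (hbi.add (circleIntegrable_const _ _ _))
    hle).trans ?_
  rw [Real.circleAverage_add hbi (circleIntegrable_const _ _ _), Real.circleAverage_const]
  have : Real.circleAverage (fun z => 2 * ((1 + B)⁻¹ * b z)) 0 r =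
      2 * ((1 + B)⁻¹ * Real.circleAverage b 0 r) := by
    rw [Real.circleAverage_def, Real.circleAverage_def, smul_eq_mul, smul_eq_mul,
      intervalIntegral.integral_const_mul, intervalIntegral.integral_const_mul]
    ring
  rw [this]
  have h7 : (1 + B)⁻¹ * Real.circleAverage b 0 r ≤ (1 + B)⁻¹ * B := by gcongr
  have h8 : (1 + B)⁻¹ * B = 1 - (1 + B)⁻¹ := by field_simp; ring
  linarith

theorem sqrt_sum_le_sum_sqrt {ι : Type*} (s : Finset ι) (f : ι → ℝ) (hf : ∀ i ∈ s, 0 ≤ f i) :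
    √(∑ i ∈ s, f i) ≤ ∑ i ∈ s, √(f i) := by
  refine Real.sqrt_le_iff.2 ⟨Finset.sum_nonneg fun _ _ => Real.sqrt_nonneg _, ?_⟩
  refine le_trans (le_of_eq ?_) (Finset.sum_sq_le_sq_sum_of_nonneg fun i _ => Real.sqrt_nonneg _)
  exact Finset.sum_congr rfl fun i hi => (Real.sq_sqrt (hf i hi)).symm

theorem sqrt_add_le_sqrt_add_sqrt {x y : ℝ} (hx : 0 ≤ x) (hy : 0 ≤ y) : √(x + y) ≤ √x + √y := by
  rw [Real.sqrt_le_iff]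
  have h1 : 0 ≤ √x * √y := by positivity
  have h2 := Real.sq_sqrt hx
  have h3 := Real.sq_sqrt hy
  exact ⟨by positivity, by nlinarith⟩

/-! ### Splitting off finitely many zeros and poles. -/

/-- A meromorphic function with finitely many zeros and poles in `U` factors there as a rational
function times a zero-free analytic function. -/
theorem exists_factorization_of_finite_support {h : ℂ → ℂ} (hh : Meromorphic h)
    (h0 : ∀ z, meromorphicOrderAt h z ≠ ⊤) {U : Set ℂ}
    (hfin : (MeromorphicOn.divisor h U).support.Finite) :
    ∃ (S : Finset ℂ) (G : ℂ → ℂ), (∀ u ∈ S, u ∈ U) ∧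
      AnalyticOnNhd ℂ G U ∧ (∀ z ∈ U, G z ≠ 0) ∧
      h =ᶠ[codiscreteWithin U] (fun z =>
        (∏ u ∈ S, (z - u) ^ MeromorphicOn.divisor h Set.univ u) * G z) ∧
      (fun z => Real.log ‖h z‖) =ᶠ[codiscreteWithin U] (fun z =>
        ∑ u ∈ S, (MeromorphicOn.divisor h Set.univ u : ℝ) * Real.log ‖z - u‖ + Real.log ‖G z‖) ∧
      logDeriv h =ᶠ[codiscreteWithin U] (fun z =>
        ∑ u ∈ S, (MeromorphicOn.divisor h Set.univ u : ℂ) * (z - u)⁻¹ + logDeriv G z) := by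
  classical
  set D := MeromorphicOn.divisor h U with hD
  obtain ⟨G, hG, hG0, hhG⟩ := (hh.meromorphicOn (s := U)).extract_zeros_poles (fun u => h0 u) hfin
  rw [← hD] at hhG
  have hDuniv : ∀ u ∈ hfin.toFinset, MeromorphicOn.divisor h Set.univ u = D u := by
    intro u hu
    have hu' : u ∈ U := D.supportWithinDomain (hfin.mem_toFinset.1 hu)
    rw [hD, MeromorphicOn.divisor_apply hh.meromorphicOn hu',
      MeromorphicOn.divisor_apply hh.meromorphicOn (Set.mem_univ u)]
  refine ⟨hfin.toFinset, G, ?_, hG, fun z hz => hG0 ⟨z, hz⟩, ?_, ?_, ?_⟩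
  · intro u hu
    exact D.supportWithinDomain (hfin.mem_toFinset.1 hu)
  · filter_upwards [hhG] with z hz
    rw [hz, Pi.smul_apply', smul_eq_mul]
    congr 1
    rw [finprod_eq_prod_of_mulSupport_subset (s := hfin.toFinset), Finset.prod_apply]
    · exact Finset.prod_congr rfl fun u hu => by rw [hDuniv u hu]; rfl
    · rw [Function.FactorizedRational.mulSupport, Set.Finite.coe_toFinset]
  · filter_upwards [MeromorphicOn.extract_zeros_poles_log hG0 hhG] with z hz
    rw [hz, Pi.add_apply]
    congr 1
    rw [finsum_eq_sum_of_support_subset (s := hfin.toFinset), Finset.sum_apply]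
    · exact Finset.sum_congr rfl fun u hu => by rw [hDuniv u hu]
    · intro u hu
      rw [Set.Finite.coe_toFinset]
      by_contra hcon
      have : D u = 0 := by simpa using hcon
      exact hu (by simp only [this, Int.cast_zero, zero_mul]; rfl)
  · have hP : MeromorphicOn (∏ᶠ u, (fun x : ℂ => x - u) ^ D u) U :=
      (Function.FactorizedRational.meromorphicNFOn D U).meromorphicOn
    have hGm : MeromorphicOn G U := hG.meromorphicOn
    have hGtop : ∀ z ∈ U, meromorphicOrderAt G z ≠ ⊤ := fun z hz => by
      rw [(hG z hz).meromorphicOrderAt_eq, (hG z hz).analyticOrderAt_eq_zero.2 (hG0 ⟨z, hz⟩)]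
      simp
    have h1 := hP.logDeriv_mul_eventuallyEq hGm
      (fun z _ => Function.FactorizedRational.meromorphicOrderAt_ne_top D) hGtop
    have h2 := MeromorphicOn.logDeriv_finprod_zpow_eventuallyEq (U := U) (d := D)
      (F := fun (u : ℂ) (x : ℂ) => x - u) hfin (fun u z _ => by fun_prop) (fun u z _ => by
        have := (analyticAt_id (𝕜 := ℂ) (z := z)).sub (analyticAt_const (v := u))
        rw [Ne, meromorphicOrderAt_eq_top_iff]
        intro hcon
        have h3 : ∀ᶠ y in 𝓝[≠] z, y ≠ u := by
          rcases eq_or_ne z u with rfl | hne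
          · exact eventually_mem_nhdsWithin
          · exact (eventually_ne_nhds hne).filter_mono nhdsWithin_le_nhds
        obtain ⟨y, hy1, hy2⟩ := (hcon.and h3).exists
        exact hy2 (sub_eq_zero.1 hy1))
    rw [smul_eq_mul] at hhG
    have h3 := (hh.meromorphicOn (s := U)).deriv_eventuallyEq_codiscreteWithin (hP.mul hGm) hhG
    filter_upwards [h1, h2, h3, hhG] with z hz1 hz2 hz3 hz4
    rw [logDeriv_apply, hz3, hz4, ← logDeriv_apply, hz1, Pi.add_apply, hz2]
    congr 1
    rw [finsum_eq_sum_of_support_subset (s := hfin.toFinset)]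
    · refine Finset.sum_congr rfl fun u hu => ?_
      rw [hDuniv u hu, zsmul_eq_mul, logDeriv_apply]
      congr 1
      rw [deriv_sub_const, deriv_id'', one_div]
    · intro u hu
      rw [Set.Finite.coe_toFinset]
      by_contra hcon
      have : D u = 0 := by simpa using hcon
      exact hu (by simp [this])

theorem exists_factorization_closedBall {h : ℂ → ℂ} (hh : Meromorphic h)
    (h0 : ∀ z, meromorphicOrderAt h z ≠ ⊤) (R : ℝ) :
    ∃ (S : Finset ℂ) (G : ℂ → ℂ), (∀ u ∈ S, ‖u‖ ≤ R) ∧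
      AnalyticOnNhd ℂ G (Metric.closedBall 0 R) ∧ (∀ z ∈ Metric.closedBall (0 : ℂ) R, G z ≠ 0) ∧
      (fun z => Real.log ‖h z‖) =ᶠ[codiscreteWithin (Metric.closedBall 0 R)] (fun z =>
        ∑ u ∈ S, (MeromorphicOn.divisor h Set.univ u : ℝ) * Real.log ‖z - u‖ + Real.log ‖G z‖) ∧
      logDeriv h =ᶠ[codiscreteWithin (Metric.closedBall 0 R)] (fun z =>
        ∑ u ∈ S, (MeromorphicOn.divisor h Set.univ u : ℂ) * (z - u)⁻¹ + logDeriv G z) := by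
  obtain ⟨S, G, hS, hG, hG0, -, hlog, hderiv⟩ := exists_factorization_of_finite_support hh h0
    ((MeromorphicOn.divisor h (Metric.closedBall 0 R)).finiteSupport (isCompact_closedBall 0 R))
  exact ⟨S, G, fun u hu => by simpa using hS u hu, hG, hG0, hlog, hderiv⟩

/-- The zero-free factor inherits a mean bound from `h`: its logarithm is `log ‖h‖` minus the linear
factors, each with mean at most `2 log (2R)` in absolute value. -/
theorem circleAverage_abs_log_norm_factor_le {h G : ℂ → ℂ} (hh : Meromorphic h) {R : ℝ}
    (hR : 1 ≤ R) {S : Finset ℂ} (c : ℂ → ℝ) (hS : ∀ u ∈ S, ‖u‖ ≤ R)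
    (hG : MeromorphicOn G (Metric.sphere 0 |R|))
    (hhG : (fun z => Real.log ‖h z‖) =ᶠ[codiscreteWithin (Metric.sphere 0 |R|)] (fun z =>
        ∑ u ∈ S, c u * Real.log ‖z - u‖ + Real.log ‖G z‖)) :
    Real.circleAverage (fun z => |Real.log ‖G z‖|) 0 R ≤
      proximity h ⊤ R + proximity h⁻¹ ⊤ R + (∑ u ∈ S, |c u|) * (2 * Real.log (2 * R)) := by
  have hR0 : R ≠ 0 := by linarith
  have hint : CircleIntegrable (fun z => |Real.log ‖h z‖|) 0 R :=
    hh.meromorphicOn.circleIntegrable_log_norm.abs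
  have hintS : ∀ u ∈ S, CircleIntegrable (fun z => |c u| * |Real.log ‖z - u‖|) 0 R := fun u _ =>
    IntervalIntegrable.const_mul (circleIntegrable_log_norm_sub_const R).abs _
  have hintsum : CircleIntegrable (fun z => ∑ u ∈ S, |c u| * |Real.log ‖z - u‖|) 0 R := by
    have := CircleIntegrable.sum S hintS
    convert this using 1
    ext z
    simp
  have hGint : CircleIntegrable (fun z => |Real.log ‖G z‖|) 0 R := hG.circleIntegrable_log_norm.abs
  -- The factorization holds only off a discrete set. Taking the minimum gives a function with the
  -- same mean that obeys the bound at every point of the circle.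
  set F : ℂ → ℝ := fun z => min |Real.log ‖G z‖| (|Real.log ‖h z‖| +
    ∑ u ∈ S, |c u| * |Real.log ‖z - u‖|) with hF
  have hFeq : (fun z => |Real.log ‖G z‖|) =ᶠ[codiscreteWithin (Metric.sphere 0 |R|)] F := by
    filter_upwards [hhG] with z hz
    refine (min_eq_left ?_).symm
    have h1 : Real.log ‖G z‖ = Real.log ‖h z‖ - ∑ u ∈ S, c u * Real.log ‖z - u‖ := by
      rw [hz]; ring
    rw [h1]
    refine (abs_sub _ _).trans (add_le_add le_rfl ?_)
    refine (Finset.abs_sum_le_sum_abs _ _).trans (le_of_eq ?_)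
    exact Finset.sum_congr rfl fun u _ => abs_mul _ _
  rw [Real.circleAverage_congr_codiscreteWithin hFeq hR0]
  have h2 : Real.circleAverage F 0 R ≤ Real.circleAverage
      (fun z => |Real.log ‖h z‖| + ∑ u ∈ S, |c u| * |Real.log ‖z - u‖|) 0 R :=
    Real.circleAverage_mono (hGint.congr_codiscreteWithin hFeq) (hint.add hintsum)
      fun z _ => min_le_right _ _
  refine h2.trans ?_
  rw [Real.circleAverage_fun_add hint hintsum, circleAverage_abs_log_norm_eq hh,
    Real.circleAverage_fun_sum hintS, Finset.sum_mul]
  refine add_le_add le_rfl (Finset.sum_le_sum fun u hu => ?_)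
  have h3 := Real.circleAverage_fun_smul (a := |c u|) (f := fun z => |Real.log ‖z - u‖|)
    (c := 0) (R := R)
  simp only [smul_eq_mul] at h3
  rw [h3]
  exact mul_le_mul_of_nonneg_left
    (circleAverage_abs_log_norm_sub_le hR (by simpa using hS u hu)) (abs_nonneg _)

/-! ### Logarithmic derivative on two concentric circles. -/

/-- A quantitative form of the lemma on the logarithmic derivative. -/
theorem exists_proximity_logDeriv_le :
    ∃ K : ℝ, 0 ≤ K ∧ ∀ h : ℂ → ℂ, Meromorphic h → (∀ z, meromorphicOrderAt h z ≠ ⊤) →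
      ∀ r R n : ℝ, 1 ≤ r → r < R → (∀ S : Finset ℂ, (∀ u ∈ S, ‖u‖ ≤ R) →
        ∑ u ∈ S, |(MeromorphicOn.divisor h Set.univ u : ℝ)| ≤ n) →
      proximity (logDeriv h) ⊤ r ≤ 2 * Real.log (1 + (n * K + (1 + 2 * R / (R - r) ^ 2 *
        (proximity h ⊤ R + proximity h⁻¹ ⊤ R + n * (2 * Real.log (2 * R)))))) := by
  obtain ⟨K, hK0, hK⟩ := exists_circleAverage_inv_sqrt_norm_sub_le
  refine ⟨K, hK0, fun h hh h0 r R n hr hrR hn => ?_⟩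
  obtain ⟨S, G, hS, hG, hG0, hlog, hderiv⟩ := exists_factorization_closedBall hh h0 R
  have hR : 1 ≤ R := hr.trans hrR.le
  have hr0 : r ≠ 0 := by linarith
  have hn0 : 0 ≤ n := by simpa using hn ∅ (by simp)
  have hlogR : 0 ≤ Real.log (2 * R) := Real.log_nonneg (by linarith)
  have hsphR : Metric.sphere (0 : ℂ) |R| ⊆ Metric.closedBall 0 R := by
    rw [abs_of_pos (by linarith)]; exact Metric.sphere_subset_closedBall
  have hsphr : Metric.sphere (0 : ℂ) |r| ⊆ Metric.closedBall 0 R := by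
    rw [abs_of_pos (by linarith)]
    exact Metric.sphere_subset_closedBall.trans (Metric.closedBall_subset_closedBall hrR.le)
  set A := proximity h ⊤ R + proximity h⁻¹ ⊤ R + n * (2 * Real.log (2 * R)) with hA
  have hA0 : 0 ≤ A := add_nonneg (add_nonneg (proximity_nonneg R) (proximity_nonneg R))
    (by positivity)
  have hGavg : Real.circleAverage (fun z => |Real.log ‖G z‖|) 0 R ≤ A := by
    refine (circleAverage_abs_log_norm_factor_le hh hR _ hS
      (hG.meromorphicOn.mono_set hsphR)
      (hlog.filter_mono (codiscreteWithin_mono hsphR))).trans ?_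
    rw [hA]
    gcongr
    exact hn S hS
  set E := 2 * R / (R - r) ^ 2 * A with hE
  have hE0 : 0 ≤ E := by positivity
  set L : ℂ → ℂ := fun z => ∑ u ∈ S, (MeromorphicOn.divisor h Set.univ u : ℂ) * (z - u)⁻¹ +
    logDeriv G z with hL
  have hLeq : logDeriv h =ᶠ[codiscreteWithin (Metric.sphere 0 |r|)] L :=
    hderiv.filter_mono (codiscreteWithin_mono hsphr)
  have hLint : CircleIntegrable (fun z => Real.posLog ‖L z‖) 0 r := by
    refine (hh.logDeriv.meromorphicOn.circleIntegrable_posLog_norm).congr_codiscreteWithin ?_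
    filter_upwards [hLeq] with z hz
    rw [hz]
  rw [proximity_congr_codiscreteWithin hLeq hr0, proximity_top]
  -- A majorant of `√‖L‖`: the root is subadditive, and `‖z - u‖ ^ (-1/2)` stays integrable when `u`
  -- lies on the circle, unlike `‖z - u‖⁻¹`. The last summand uses `√E ≤ 1 + E`.
  set b : ℂ → ℝ := fun z =>
    ∑ u ∈ S, |(MeromorphicOn.divisor h Set.univ u : ℝ)| * (√‖z - u‖)⁻¹ + (1 + E) with hb
  have hbS : ∀ u ∈ S, CircleIntegrable
      (fun z => |(MeromorphicOn.divisor h Set.univ u : ℝ)| * (√‖z - u‖)⁻¹) 0 r := fun u _ =>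
    IntervalIntegrable.const_mul (hK r hr u).1 _
  have hbsum : CircleIntegrable (fun z =>
      ∑ u ∈ S, |(MeromorphicOn.divisor h Set.univ u : ℝ)| * (√‖z - u‖)⁻¹) 0 r := by
    have := CircleIntegrable.sum S hbS
    convert this using 1
    ext z
    simp
  have hbint : CircleIntegrable b 0 r := hbsum.add (circleIntegrable_const _ _ _)
  refine circleAverage_posLog_le hLint hbint ?_ ?_ (by positivity)
  · intro z hz
    have hz' : ‖z‖ = r := by simpa [abs_of_pos (by linarith : 0 < r)] using hz
    have h1 : ‖L z‖ ≤ ∑ u ∈ S, |(MeromorphicOn.divisor h Set.univ u : ℝ)| * ‖z - u‖⁻¹ +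
        ‖logDeriv G z‖ := by
      refine (norm_add_le _ _).trans (add_le_add ((norm_sum_le _ _).trans (le_of_eq ?_)) le_rfl)
      refine Finset.sum_congr rfl fun u _ => ?_
      rw [norm_mul, norm_inv, Complex.norm_intCast]
    have h2 : ‖logDeriv G z‖ ≤ E := by
      refine (norm_logDeriv_le_circleAverage hG hG0 (by simpa [hz'] using hrR)).trans ?_
      rw [hz', hE]
      gcongr
    have h3 : √‖logDeriv G z‖ ≤ 1 + E := by
      rw [Real.sqrt_le_iff]
      constructor <;> nlinarith
    refine (Real.sqrt_le_sqrt h1).trans ((sqrt_add_le_sqrt_add_sqrt (by positivity) (by positivity)).trans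
      (add_le_add ((sqrt_sum_le_sum_sqrt _ _ fun u _ => by positivity).trans ?_) h3))
    refine Finset.sum_le_sum fun u _ => ?_
    rw [Real.sqrt_mul (abs_nonneg _), Real.sqrt_inv]
    refine mul_le_mul_of_nonneg_right ?_ (by positivity)
    -- Multiplicities are integers, so `√|m| ≤ |m|`.
    rw [Real.sqrt_le_iff]
    refine ⟨abs_nonneg _, ?_⟩
    have h4 : |MeromorphicOn.divisor h Set.univ u| ≤ |MeromorphicOn.divisor h Set.univ u| ^ 2 :=
      Int.le_self_sq _
    exact_mod_cast h4
  · rw [hb, Real.circleAverage_fun_add hbsum (circleIntegrable_const _ _ _),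
      Real.circleAverage_const, Real.circleAverage_fun_sum hbS]
    refine add_le_add ?_ le_rfl
    refine le_trans (Finset.sum_le_sum fun u hu => ?_)
      (le_trans (le_of_eq (Finset.sum_mul _ _ K).symm)
        (mul_le_mul_of_nonneg_right (hn S hS) hK0))
    have h3 := Real.circleAverage_fun_smul (a := |(MeromorphicOn.divisor h Set.univ u : ℝ)|)
      (f := fun z => (√‖z - u‖)⁻¹) (c := 0) (R := r)
    simp only [smul_eq_mul] at h3
    rw [h3]
    exact mul_le_mul_of_nonneg_left (hK r hr u).2 (abs_nonneg _)

/-! ### Growth lemma and lemma on the logarithmic derivative. -/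

/-- Borel's growth lemma, for a monotone function that need not be continuous. -/
theorem exists_borel_exceptional_set {T : ℝ → ℝ} (hT : MonotoneOn T (Set.Ioi 0))
    (hT1 : ∀ r, 1 ≤ T r) :
    ∃ E : Set ℝ, E ⊆ Set.Ioi 0 ∧ MeasurableSet E ∧ volume E < ⊤ ∧
      ∀ r, 1 ≤ r → r ∉ E → T (r + (T r)⁻¹) ≤ 2 * T r := by
  -- The bad radii are sorted by the dyadic size of `T`. Two of them in the same class are at most
  -- `2 ^ (-n)` apart, since beyond `x + (T x)⁻¹` the function exceeds `2 T x ≥ 2 ^ (n + 1)`. The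
  -- diameters have a finite sum.
  set A : ℕ → Set ℝ := fun n =>
    {r | 1 ≤ r ∧ (2 : ℝ) ^ n ≤ T r ∧ T r < 2 ^ (n + 1) ∧ 2 * T r < T (r + (T r)⁻¹)} with hA
  have hkey : ∀ n, ∀ x ∈ A n, ∀ y ∈ A n, x ≤ y → y - x ≤ (1 / 2 : ℝ) ^ n := by
    intro n x hx y hy hxy
    have hTx : 0 < T x := by linarith [hT1 x]
    have h1 : y ≤ x + (T x)⁻¹ := by
      by_contra! hcon
      have h2 : T (x + (T x)⁻¹) ≤ T y := hT
        (by have := hx.1; have := inv_pos.2 hTx; simp only [Set.mem_Ioi]; linarith)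
        (by have := hy.1; simp only [Set.mem_Ioi]; linarith) hcon.le
      have h3 := hx.2.2.2
      have h4 := hx.2.1
      have h5 := hy.2.2.1
      rw [pow_succ] at h5
      linarith
    have h2 : (T x)⁻¹ ≤ (1 / 2 : ℝ) ^ n := by
      rw [one_div, inv_pow]
      exact inv_anti₀ (by positivity) hx.2.1
    linarith
  have hvol : ∀ n, volume (A n) ≤ (2 : ENNReal)⁻¹ ^ n := by
    intro n
    refine (Real.volume_le_diam _).trans (Metric.ediam_le fun x hx y hy => ?_)
    have h1 : |x - y| ≤ (1 / 2 : ℝ) ^ n := by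
      rcases le_total x y with hxy | hxy
      · rw [abs_sub_comm, abs_of_nonneg (by linarith)]; exact hkey n x hx y hy hxy
      · rw [abs_of_nonneg (by linarith)]; exact hkey n y hy x hx hxy
    rw [edist_dist, Real.dist_eq]
    refine (ENNReal.ofReal_le_ofReal h1).trans (le_of_eq ?_)
    rw [ENNReal.ofReal_pow (by norm_num), one_div, ENNReal.ofReal_inv_of_pos (by norm_num)]
    simp
  have hUvol : volume (⋃ n, A n) < ⊤ := by
    refine (measure_iUnion_le _).trans_lt ((ENNReal.tsum_le_tsum hvol).trans_lt ?_)
    rw [ENNReal.tsum_geometric]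
    simp
  -- A measurable hull has the same measure and makes the exceptional set measurable.
  refine ⟨toMeasurable volume (⋃ n, A n) ∩ Set.Ioi 0, Set.inter_subset_right,
    (measurableSet_toMeasurable _ _).inter measurableSet_Ioi, ?_, ?_⟩
  · refine (measure_mono Set.inter_subset_left).trans_lt ?_
    rwa [measure_toMeasurable]
  · intro r hr hrE
    by_contra! hcon
    refine hrE ⟨subset_toMeasurable _ _ ?_, by simp only [Set.mem_Ioi]; linarith⟩
    obtain ⟨n, hn1, hn2⟩ := exists_nat_pow_near (hT1 r) (by norm_num : (1 : ℝ) < 2)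
    exact Set.mem_iUnion.2 ⟨n, hr, hn1, hn2, hcon⟩

theorem exists_abs_characteristic_sub_inv_le {h : ℂ → ℂ} (hh : Meromorphic h) :
    ∃ c : ℝ, 0 ≤ c ∧ ∀ r, |characteristic h ⊤ r - characteristic h⁻¹ ⊤ r| ≤ c :=
  ⟨_, le_max_of_le_left (abs_nonneg _), fun _ => characteristic_sub_characteristic_inv_le hh⟩

/-- The lemma on the logarithmic derivative. -/
theorem exists_proximity_logDeriv_le_log {h : ℂ → ℂ} (hh : Meromorphic h)
    (h0 : ∀ z, meromorphicOrderAt h z ≠ ⊤) :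
    ∃ C : ℝ, ∃ E : Set ℝ, E ⊆ Set.Ioi 0 ∧ MeasurableSet E ∧ volume E < ⊤ ∧
      ∀ r, 1 ≤ r → r ∉ E → proximity (logDeriv h) ⊤ r ≤
        C + 6 * Real.log r + 8 * Real.log (max (characteristic h ⊤ r) 1) := by
  obtain ⟨K, hK0, hK⟩ := exists_proximity_logDeriv_le
  obtain ⟨c, hc0, hc⟩ := exists_abs_characteristic_sub_inv_le hh
  set τ : ℝ → ℝ := fun r => max (characteristic h ⊤ r) 1 with hτ
  have hτmono : MonotoneOn τ (Set.Ioi 0) := fun a ha b hb hab =>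
    max_le_max (characteristic_monotoneOn hh ha hb hab) le_rfl
  obtain ⟨E, hE0, hEm, hEv, hE⟩ := exists_borel_exceptional_set hτmono fun r => le_max_right _ _
  -- The argument of the logarithm is bounded by a constant times `r ^ 3 * t ^ 4`. Here `2` collects
  -- the two ones, `4 * K` comes from `n * K`, and `528 = 16 + 16 * 32` comes from the Poisson term.
  -- Twice the logarithm gives the coefficients `6` and `8`.
  refine ⟨2 * Real.log (2 + (4 + c) * (4 * K + 528)), E, hE0, hEm, hEv, fun r hr hrE => ?_⟩
  set t := τ r with ht
  have ht1 : 1 ≤ t := le_max_right _ _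
  have ht0 : 0 < t := by linarith
  have hti : t⁻¹ ≤ 1 := inv_le_one_of_one_le₀ ht1
  have hti0 : 0 < t⁻¹ := inv_pos.2 ht0
  have hr0 : 0 < r := by linarith
  set ρ := r + t⁻¹ with hρ
  set R := r + t⁻¹ / 2 with hR
  have hrR : r < R := by linarith
  have hRρ : R < ρ := by linarith
  have hρ2 : ρ ≤ 2 * r := by linarith
  have hsum : ∀ s, r ≤ s → s ≤ ρ →
      characteristic h ⊤ s + characteristic h⁻¹ ⊤ s ≤ (4 + c) * t := by
    intro s hrs hsρ
    have h1 : characteristic h ⊤ s ≤ 2 * t := by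
      refine le_trans ?_ (hE r hr hrE)
      refine le_trans (le_max_left _ 1) (hτmono ?_ ?_ hsρ) <;>
        simp only [Set.mem_Ioi] <;> linarith
    have h2 := abs_le.1 (hc s)
    nlinarith
  -- The counting functions at `ρ` total at most `(4 + c) * t`, and `log ρ - log R ≥ 1 - R / ρ = 1 /
  -- (2tρ) ≥ 1 / (4tr)`; the quotient bounds the number of zeros and poles up to radius `R`.
  set n := (4 + c) * t * (4 * t * r) with hn
  have hlogdiff : (4 * t * r)⁻¹ ≤ Real.log ρ - Real.log R := by
    have hR0 : 0 < R := by linarith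
    have hρ0 : 0 < ρ := by linarith
    have h1 := Real.one_sub_inv_le_log_of_pos (x := ρ / R) (by positivity)
    rw [Real.log_div hρ0.ne' hR0.ne', inv_div] at h1
    refine le_trans ?_ h1
    have h2 : 1 - R / ρ = (2 * t * ρ)⁻¹ := by
      rw [show R = ρ - t⁻¹ / 2 by rw [hR, hρ]; ring]
      field_simp
      ring
    rw [h2]
    exact inv_anti₀ (by positivity) (by nlinarith)
  have hbound := hK h hh h0 r R n hr hrR ?_
  swap
  · intro S hS
    have h1 := sum_abs_divisor_mul_log_sub_le (h := h) (hr.trans hrR.le) hRρ.le hS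
    have h2 : logCounting h ⊤ ρ + logCounting h 0 ρ ≤ (4 + c) * t := by
      refine le_trans ?_ (hsum ρ (by linarith) le_rfl)
      rw [← logCounting_inv (f := h)]
      have h3 := proximity_nonneg (f := h) (a := ⊤) ρ
      have h4 := proximity_nonneg (f := h⁻¹) (a := ⊤) ρ
      simp only [characteristic, Pi.add_apply, Pi.zero_apply] at *
      linarith
    have h5 : (∑ u ∈ S, |(MeromorphicOn.divisor h Set.univ u : ℝ)|) * (4 * t * r)⁻¹ ≤
        (4 + c) * t :=
      (mul_le_mul_of_nonneg_left hlogdiff (Finset.sum_nonneg fun _ _ => abs_nonneg _)).trans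
        (h1.trans h2)
    rwa [← div_eq_mul_inv, div_le_iff₀ (by positivity)] at h5
  have hprox : proximity h ⊤ R + proximity h⁻¹ ⊤ R ≤ (4 + c) * t := by
    refine le_trans ?_ (hsum R hrR.le hRρ.le)
    have h3 := logCounting_nonneg (f := h) (e := ⊤) (hr.trans hrR.le)
    have h4 := logCounting_nonneg (f := h⁻¹) (e := ⊤) (hr.trans hrR.le)
    simp only [characteristic, Pi.add_apply]
    linarith
  have hfac : 2 * R / (R - r) ^ 2 ≤ 16 * r * t ^ 2 := by
    rw [show R - r = t⁻¹ / 2 by rw [hR]; ring]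
    rw [div_le_iff₀ (by positivity)]
    have : 16 * r * t ^ 2 * (t⁻¹ / 2) ^ 2 = 4 * r := by
      field_simp; ring
    linarith
  have hlogR : Real.log (2 * R) ≤ 4 * r :=
    (Real.log_le_self (by linarith)).trans (by linarith)
  have hn0 : 0 ≤ n := by positivity
  have hA0 : 0 ≤ proximity h ⊤ R + proximity h⁻¹ ⊤ R + n * (2 * Real.log (2 * R)) :=
    add_nonneg (add_nonneg (proximity_nonneg R) (proximity_nonneg R))
      (mul_nonneg hn0 (mul_nonneg zero_le_two (Real.log_nonneg (by linarith))))
  have hB : 1 + (n * K + (1 + 2 * R / (R - r) ^ 2 *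
      (proximity h ⊤ R + proximity h⁻¹ ⊤ R + n * (2 * Real.log (2 * R))))) ≤
      (2 + (4 + c) * (4 * K + 528)) * (r ^ 3 * t ^ 4) := by
    have h1 : 2 * R / (R - r) ^ 2 *
      (proximity h ⊤ R + proximity h⁻¹ ⊤ R + n * (2 * Real.log (2 * R))) ≤
        16 * r * t ^ 2 * ((4 + c) * t + n * (2 * (4 * r))) := by
      gcongr
    have p1 : 1 ≤ r ^ 3 * t ^ 4 := one_le_mul_of_one_le_of_one_le (one_le_pow₀ hr) (one_le_pow₀ ht1)
    have p2 : t ^ 2 * r ≤ r ^ 3 * t ^ 4 := by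
      have h2 : r ≤ r ^ 3 := le_self_pow₀ hr (by norm_num)
      have h3 : t ^ 2 ≤ t ^ 4 := pow_le_pow_right₀ ht1 (by norm_num)
      rw [mul_comm (r ^ 3)]
      gcongr
    have p3 : r * t ^ 3 ≤ r ^ 3 * t ^ 4 := by
      have h2 : r ≤ r ^ 3 := le_self_pow₀ hr (by norm_num)
      have h3 : t ^ 3 ≤ t ^ 4 := pow_le_pow_right₀ ht1 (by norm_num)
      gcongr
    have q2 : (4 + c) * (4 * K) * (t ^ 2 * r) ≤ (4 + c) * (4 * K) * (r ^ 3 * t ^ 4) := by gcongr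
    have q3 : (4 + c) * 16 * (r * t ^ 3) ≤ (4 + c) * 16 * (r ^ 3 * t ^ 4) := by gcongr
    rw [hn] at h1 ⊢
    nlinarith
  refine hbound.trans ?_
  have hBpos : 0 < 1 + (n * K + (1 + 2 * R / (R - r) ^ 2 *
      (proximity h ⊤ R + proximity h⁻¹ ⊤ R + n * (2 * Real.log (2 * R))))) := by
    have hR0 : 0 < R := by linarith
    positivity
  have hlog := Real.log_le_log hBpos hB
  have hC0 : 0 < 2 + (4 + c) * (4 * K + 528) := by positivity
  have hlogC : Real.log ((2 + (4 + c) * (4 * K + 528)) * (r ^ 3 * t ^ 4)) =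
      Real.log (2 + (4 + c) * (4 * K + 528)) + (3 * Real.log r + 4 * Real.log t) := by
    rw [Real.log_mul hC0.ne' (by positivity), Real.log_mul (by positivity) (by positivity),
      Real.log_pow, Real.log_pow]
    norm_num
  rw [hlogC] at hlog
  change _ ≤ 2 * Real.log (2 + (4 + c) * (4 * K + 528)) + 6 * Real.log r + 8 * Real.log t
  linarith

/-! ### Logarithmic growth characterizes rational functions. -/

/-- More than `C` points of the divisor would force growth `m log r - O(1)` with `m > C`, against
the bound at arbitrarily large radii. -/
theorem finite_support_of_frequently_logCounting_le {D : Function.locallyFinsupp ℂ ℤ}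
    (hD : 0 ≤ D) {C : ℝ}
    (h : ∃ᶠ r in atTop, Function.locallyFinsuppWithin.logCounting D r ≤ C * Real.log r) :
    D.support.Finite := by
  by_contra hinf
  obtain ⟨m, hm⟩ := exists_nat_gt (max C 0)
  obtain ⟨S, hSD, hcard⟩ := Set.Infinite.exists_subset_card_eq hinf m
  set R := 1 + ∑ u ∈ S, ‖u‖ with hR
  have hR1 : 1 ≤ R := by
    have : 0 ≤ ∑ u ∈ S, ‖u‖ := Finset.sum_nonneg fun _ _ => norm_nonneg _
    linarith
  have hSR : ∀ u ∈ S, ‖u‖ ≤ R := fun u hu => by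
    have := Finset.single_le_sum (f := fun u : ℂ => ‖u‖) (fun _ _ => norm_nonneg _) hu
    linarith
  have hDm : (m : ℝ) ≤ ∑ u ∈ S, (D u : ℝ) := by
    rw [← hcard, ← nsmul_one, ← Finset.sum_const]
    refine Finset.sum_le_sum fun u hu => ?_
    have h1 : 0 ≤ D u := hD u
    have h2 : D u ≠ 0 := hSD hu
    have : 1 ≤ D u := by omega
    exact_mod_cast this
  have hCm : C < m := (le_max_left _ _).trans_lt hm
  have hev : ∀ᶠ r : ℝ in atTop, m * Real.log R / (m - C) < Real.log r :=
    Real.tendsto_log_atTop.eventually_gt_atTop _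
  obtain ⟨r, hr1, hr2, hr3⟩ := (h.and_eventually (hev.and (eventually_ge_atTop R))).exists
  have h1 := sum_mul_log_sub_le_logCounting hD hR1 hr3 hSR
  have h2 : 0 ≤ Real.log r - Real.log R :=
    sub_nonneg.2 (Real.log_le_log (by linarith) hr3)
  have h3 : m * (Real.log r - Real.log R) ≤ C * Real.log r :=
    (mul_le_mul_of_nonneg_right hDm h2).trans (h1.trans hr1)
  rw [div_lt_iff₀ (by linarith)] at hr2
  linarith

/-- A meromorphic function whose characteristic is `O(log r)` on an unbounded set of radii is
rational. -/
theorem exists_rational_of_frequently_characteristic_le {h : ℂ → ℂ} (hh : Meromorphic h)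
    (h0 : ∀ z, meromorphicOrderAt h z ≠ ⊤) {C : ℝ}
    (hC : ∃ᶠ r in atTop, characteristic h ⊤ r ≤ C * Real.log r) :
    ∃ P Q : Polynomial ℂ, Q ≠ 0 ∧ SameMeromorphic h (fun z => P.eval z / Q.eval z) := by
  classical
  obtain ⟨c, hc0, hc⟩ := exists_abs_characteristic_sub_inv_le hh
  have hlog1 : ∀ᶠ r : ℝ in atTop, 1 ≤ Real.log r := Real.tendsto_log_atTop.eventually_ge_atTop _
  have hpole : (MeromorphicOn.divisor h Set.univ)⁻.support.Finite := by
    refine finite_support_of_frequently_logCounting_le (negPart_nonneg _) (C := C) ?_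
    refine hC.mono fun r hr => ?_
    rw [← logCounting_top]
    have := proximity_nonneg (f := h) (a := ⊤) r
    simp only [characteristic, Pi.add_apply, Pi.zero_apply] at *
    linarith
  have hzero : (MeromorphicOn.divisor h Set.univ)⁺.support.Finite := by
    refine finite_support_of_frequently_logCounting_le (posPart_nonneg _) (C := C + c) ?_
    refine (hC.and_eventually hlog1).mono fun r ⟨hr, hr1⟩ => ?_
    rw [← logCounting_zero, ← logCounting_inv]
    have h1 := proximity_nonneg (f := h⁻¹) (a := ⊤) r
    have h2 := abs_le.1 (hc r)
    simp only [characteristic, Pi.add_apply, Pi.zero_apply] at *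
    nlinarith
  set D := MeromorphicOn.divisor h Set.univ with hD
  have hfin : D.support.Finite := by
    refine (hpole.union hzero).subset fun u hu => ?_
    by_contra hcon
    simp only [Set.mem_union, Function.mem_support, not_or, not_not,
      Function.locallyFinsuppWithin.negPart_apply,
      Function.locallyFinsuppWithin.posPart_apply] at hcon
    refine hu ?_
    rw [← posPart_sub_negPart (D u), hcon.1, hcon.2, sub_zero]
  obtain ⟨S, G, -, hG, hG0, hfac, hlog, -⟩ := exists_factorization_of_finite_support hh h0 hfin
  rw [← hD] at hfac hlog
  set R₀ := 1 + ∑ u ∈ S, ‖u‖ with hR₀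
  have hR₀1 : 1 ≤ R₀ := by
    have : 0 ≤ ∑ u ∈ S, ‖u‖ := Finset.sum_nonneg fun _ _ => norm_nonneg _
    linarith
  have hSR : ∀ u ∈ S, ‖u‖ ≤ R₀ := fun u hu => by
    have := Finset.single_le_sum (f := fun u : ℂ => ‖u‖) (fun _ _ => norm_nonneg _) hu
    linarith
  set n := ∑ u ∈ S, |(D u : ℝ)| with hn
  have hn0 : 0 ≤ n := Finset.sum_nonneg fun _ _ => abs_nonneg _
  -- The two characteristics give `2C log R + c`, and `log (2R) ≤ 2 log R` for `R ≥ 2` turns the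
  -- linear factors into `4n log R`; `c` is absorbed because `log R ≥ 1`.
  set A := 2 * C + c + 4 * n with hA
  have hbound : ∃ᶠ R : ℝ in atTop, R₀ ≤ R ∧
      Real.circleAverage (fun z => |Real.log ‖G z‖|) 0 R ≤ A * Real.log R := by
    refine (hC.and_eventually (hlog1.and (eventually_ge_atTop (max R₀ 2)))).mono
      fun R ⟨hR1, hR2, hR3⟩ => ⟨(le_max_left _ _).trans hR3, ?_⟩
    have hR4 : R₀ ≤ R := (le_max_left _ _).trans hR3
    have hR5 : 2 ≤ R := (le_max_right _ _).trans hR3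
    have h1 := circleAverage_abs_log_norm_factor_le hh (hR₀1.trans hR4) (fun u => (D u : ℝ))
      (fun u hu => (hSR u hu).trans hR4) (hG.meromorphicOn.mono_set (Set.subset_univ _))
      (hlog.filter_mono (codiscreteWithin_mono (Set.subset_univ _)))
    have h2 := abs_le.1 (hc R)
    have h3 := logCounting_nonneg (f := h) (e := ⊤) (hR₀1.trans hR4)
    have h4 := logCounting_nonneg (f := h⁻¹) (e := ⊤) (hR₀1.trans hR4)
    simp only [characteristic, Pi.add_apply] at h2 hR1
    have h5 : Real.log (2 * R) ≤ 2 * Real.log R := by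
      rw [Real.log_mul (by norm_num) (by linarith)]
      have := Real.log_le_log (by norm_num) hR5
      linarith
    have h6 : n * (2 * Real.log (2 * R)) ≤ n * (2 * (2 * Real.log R)) := by gcongr
    rw [hA]
    nlinarith
  -- A Liouville argument: for `R ≥ 2‖w‖` the Poisson bound gives `8A log R / R`, which tends to
  -- zero. Hence `G` is constant and only the rational factor remains.
  have hlogDeriv : ∀ w, logDeriv G w = 0 := by
    intro w
    by_contra hw
    have hpos : 0 < ‖logDeriv G w‖ := norm_pos_iff.2 hw
    have hlim : Tendsto (fun R : ℝ => 8 * A * (Real.log R / R)) atTop (𝓝 0) := by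
      have : Tendsto (fun R : ℝ => Real.log R / R) atTop (𝓝 0) :=
        Real.isLittleO_log_id_atTop.tendsto_div_nhds_zero
      simpa using this.const_mul (8 * A)
    obtain ⟨R, ⟨hR1, hR2⟩, hR3, hR4⟩ := (hbound.and_eventually
      ((hlim.eventually_lt_const hpos).and (eventually_ge_atTop (2 * ‖w‖ + 1)))).exists
    have hwR : ‖w‖ < R := by linarith [norm_nonneg w]
    have hR0 : 0 < R := by linarith
    have h1 := norm_logDeriv_le_circleAverage (R := R) (w := w)
      (fun z _ => hG z (Set.mem_univ _)) (fun z _ => hG0 z (Set.mem_univ _)) (by simpa using hwR)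
    have h2 : 0 ≤ Real.circleAverage (fun z => |Real.log ‖G z‖|) 0 R :=
      Real.circleAverage_nonneg_of_nonneg fun _ _ => abs_nonneg _
    have h3 : 2 * R / (R - ‖w‖) ^ 2 ≤ 8 / R := by
      have h4 : R / 2 ≤ R - ‖w‖ := by linarith
      have h5 : (R / 2) ^ 2 ≤ (R - ‖w‖) ^ 2 := by gcongr
      rw [div_le_div_iff₀ (by nlinarith) hR0]
      nlinarith
    have h4 : ‖logDeriv G w‖ ≤ 8 / R * (A * Real.log R) :=
      h1.trans (mul_le_mul h3 hR2 h2 (by positivity))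
    have h5 : 8 / R * (A * Real.log R) = 8 * A * (Real.log R / R) := by ring
    linarith
  have hGdiff : Differentiable ℂ G := fun z => (hG z (Set.mem_univ _)).differentiableAt
  have hGconst : ∀ z, G z = G 0 := fun z => is_const_of_deriv_eq_zero hGdiff (fun w => by
    have := hlogDeriv w
    rw [logDeriv_apply, div_eq_zero_iff] at this
    exact this.resolve_right (hG0 w (Set.mem_univ _))) z 0
  refine ⟨Polynomial.C (G 0) * ∏ u ∈ S, (Polynomial.X - Polynomial.C u) ^ (D u).toNat,
    ∏ u ∈ S, (Polynomial.X - Polynomial.C u) ^ (-D u).toNat, ?_, ?_⟩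
  · exact Finset.prod_ne_zero_iff.2 fun u _ => pow_ne_zero _ (Polynomial.X_sub_C_ne_zero u)
  · refine hfac.mono fun z hz => ?_
    rw [hz]
    simp only [hGconst z, Polynomial.eval_mul, Polynomial.eval_C, Polynomial.eval_prod, Polynomial.eval_pow,
      Polynomial.eval_sub, Polynomial.eval_X]
    rw [mul_comm, mul_div_assoc, ← Finset.prod_div_distrib]
    congr 1
    refine Finset.prod_congr rfl fun u _ => ?_
    rcases le_total 0 (D u) with h1 | h1
    · obtain ⟨m, hm⟩ := Int.eq_ofNat_of_zero_le h1
      simp [hm]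
    · obtain ⟨m, hm⟩ := Int.eq_ofNat_of_zero_le (neg_nonneg.2 h1)
      have : D u = -(m : ℤ) := by omega
      simp [this]

theorem meromorphicOrderAt_ne_top_of_not_sameMeromorphic_zero {h : ℂ → ℂ} (hh : Meromorphic h)
    (h0 : ¬ SameMeromorphic h 0) (z : ℂ) : meromorphicOrderAt h z ≠ ⊤ := by
  intro htop
  refine h0 ?_
  have hall : ∀ w, meromorphicOrderAt h w = ⊤ := by
    by_contra! hcon
    exact (hh.exists_meromorphicOrderAt_ne_top_iff_forall.1 hcon) z htop
  rw [SameMeromorphic, EventuallyEq, Filter.Eventually, mem_codiscrete]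
  intro x
  rw [disjoint_principal_right, compl_compl]
  exact meromorphicOrderAt_eq_top_iff.1 (hall x)

theorem TranscendentalMeromorphic.meromorphicOrderAt_ne_top {f : ℂ → ℂ}
    (hf : TranscendentalMeromorphic f) (z : ℂ) : meromorphicOrderAt f z ≠ ⊤ :=
  meromorphicOrderAt_ne_top_of_not_sameMeromorphic_zero hf.1
    (fun h => hf.2 ⟨0, 1, one_ne_zero, h.trans (by simp [EventuallyEq])⟩) z

/-- If this failed for some `c`, then `T(r, f) < c⁻¹ log r` at arbitrarily large radii, so `f` would
be rational. This is what makes constants and `log r` error terms. -/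
theorem TranscendentalMeromorphic.log_isLittleO_characteristic {f : ℂ → ℂ}
    (hf : TranscendentalMeromorphic f) : Real.log =o[atTop] characteristic f ⊤ := by
  rw [isLittleO_iff]
  intro c hc
  by_contra hcon
  refine hf.2 (exists_rational_of_frequently_characteristic_le hf.1 hf.meromorphicOrderAt_ne_top
    (C := c⁻¹) ?_)
  rw [not_eventually] at hcon
  refine (hcon.and_eventually (eventually_ge_atTop 1)).mono fun r ⟨hr, hr1⟩ => ?_
  rw [not_le, Real.norm_of_nonneg (characteristic_nonneg hr1),
    Real.norm_of_nonneg (Real.log_nonneg hr1)] at hr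
  rw [← div_eq_inv_mul, le_div_iff₀ hc]
  linarith

/-! ### No derivative of a transcendental function vanishes identically. -/

theorem sameMeromorphic_iff {f g : ℂ → ℂ} : SameMeromorphic f g ↔ ∀ x, f =ᶠ[𝓝[≠] x] g := by
  simp only [SameMeromorphic, EventuallyEq, Filter.Eventually, mem_codiscrete,
    disjoint_principal_right, compl_compl]

theorem SameMeromorphic.deriv {f g : ℂ → ℂ} (h : SameMeromorphic f g) :
    SameMeromorphic (deriv f) (deriv g) :=
  sameMeromorphic_iff.2 fun x => (sameMeromorphic_iff.1 h x).nhdsNE_deriv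

theorem SameMeromorphic.meromorphicOrderAt_eq {f g : ℂ → ℂ} (h : SameMeromorphic f g) (z : ℂ) :
    meromorphicOrderAt f z = meromorphicOrderAt g z :=
  meromorphicOrderAt_congr (sameMeromorphic_iff.1 h z)

/-- A meromorphic function with vanishing derivative is constant. -/
theorem exists_sameMeromorphic_const_of_deriv {k : ℂ → ℂ} (hk : Meromorphic k)
    (hk' : SameMeromorphic (deriv k) 0) : ∃ c, SameMeromorphic k (fun _ => c) := by
  set F := toMeromorphicNFOn k Set.univ
  have hkF : SameMeromorphic k F := toMeromorphicNFOn_eqOn_codiscrete hk.meromorphicOn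
  -- At a pole of order `n < 0` the derivative has the finite order `n - 1`, so it cannot vanish
  -- identically nearby.
  have hord : ∀ z, 0 ≤ meromorphicOrderAt k z := by
    intro z
    by_contra! hneg
    obtain ⟨n, hn⟩ := WithTop.ne_top_iff_exists.1 hneg.ne_top
    have hn0 : n ≠ 0 := by
      rintro rfl
      rw [← hn] at hneg
      exact lt_irrefl _ hneg
    have h1 := meromorphicOrderAt_deriv_eq_sub_one (n := n) (Int.cast_ne_zero.2 hn0) hn.symm
    have h2 : meromorphicOrderAt (deriv k) z = ⊤ :=
      meromorphicOrderAt_eq_top_iff.2 (sameMeromorphic_iff.1 hk' z)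
    rw [h2] at h1
    exact WithTop.top_ne_coe h1
  have hF : AnalyticOnNhd ℂ F Set.univ := fun z hz =>
    (meromorphicNFOn_toMeromorphicNFOn k Set.univ hz).meromorphicOrderAt_nonneg_iff_analyticAt.1
      (by rw [meromorphicOrderAt_toMeromorphicNFOn hk.meromorphicOn hz]; exact hord z)
  have hF' : ∀ z, deriv F z = 0 := by
    intro z
    have h1 : deriv F =ᶠ[𝓝[≠] z] 0 :=
      (sameMeromorphic_iff.1 hkF.deriv z).symm.trans (sameMeromorphic_iff.1 hk' z)
    have h2 : Tendsto (deriv F) (𝓝[≠] z) (𝓝 (deriv F z)) :=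
      (hF z (Set.mem_univ _)).deriv.continuousAt.tendsto.mono_left nhdsWithin_le_nhds
    exact tendsto_nhds_unique h2 ((tendsto_const_nhds (x := (0 : ℂ))).congr' h1.symm)
  have hFd : Differentiable ℂ F := fun z => (hF z (Set.mem_univ _)).differentiableAt
  refine ⟨F 0, hkF.trans (Eventually.of_forall fun z => is_const_of_deriv_eq_zero hFd hF' z 0)⟩

theorem exists_polynomial_derivative_eq (P : Polynomial ℂ) :
    ∃ Q : Polynomial ℂ, Polynomial.derivative Q = P := by
  induction P using Polynomial.induction_on' with
  | add p q hp hq =>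
    obtain ⟨a, rfl⟩ := hp
    obtain ⟨b, rfl⟩ := hq
    exact ⟨a + b, Polynomial.derivative_add⟩
  | monomial n a =>
    refine ⟨Polynomial.monomial (n + 1) (a / (n + 1)), ?_⟩
    rw [Polynomial.derivative_monomial]
    have : (n : ℂ) + 1 ≠ 0 := Nat.cast_add_one_ne_zero n
    simp [this]

theorem Meromorphic.iteratedDeriv {f : ℂ → ℂ} (hf : Meromorphic f) (i : ℕ) :
    Meromorphic (iteratedDeriv i f) := by
  rw [iteratedDeriv_eq_iterate]
  exact hf.iterated_deriv

/-- Integrate one derivative at a time: subtracting a polynomial antiderivative leaves a function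
with zero derivative, hence a constant. With `P = 0` it shows that `f⁽ⁱ⁾ ≡ 0` would make `f` a
polynomial. -/
theorem exists_polynomial_of_iteratedDeriv {f : ℂ → ℂ} (hf : Meromorphic f) (i : ℕ) :
    ∀ P : Polynomial ℂ, SameMeromorphic (iteratedDeriv i f) (fun z => P.eval z) →
      ∃ Q : Polynomial ℂ, SameMeromorphic f (fun z => Q.eval z) := by
  induction i with
  | zero =>
    intro P hP
    rw [iteratedDeriv_zero] at hP
    exact ⟨P, hP⟩
  | succ i ih =>
    intro P hP
    obtain ⟨Q, rfl⟩ := exists_polynomial_derivative_eq P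
    have hQ : Meromorphic fun z => Q.eval z := fun z =>
      (Polynomial.differentiable Q).analyticAt z |>.meromorphicAt
    obtain ⟨c, hc⟩ := exists_sameMeromorphic_const_of_deriv
      (k := iteratedDeriv i f - fun z => Q.eval z) ((hf.iteratedDeriv i).sub hQ) (by
        have h1 := (meromorphicOn_univ.2 (hf.iteratedDeriv i)).analyticAt_mem_codiscreteWithin
        filter_upwards [hP, h1] with z hz1 hz2
        rw [iteratedDeriv_succ] at hz1
        rw [deriv_sub hz2.differentiableAt Q.differentiableAt, hz1, Polynomial.deriv]
        simp)
    refine ih (Q + Polynomial.C c) (hc.mono fun z hz => ?_)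
    rw [Pi.sub_apply, sub_eq_iff_eq_add] at hz
    simp only [hz, Polynomial.eval_add, Polynomial.eval_C, add_comm]

theorem TranscendentalMeromorphic.meromorphicOrderAt_iteratedDeriv_ne_top {f : ℂ → ℂ}
    (hf : TranscendentalMeromorphic f) (i : ℕ) (z : ℂ) :
    meromorphicOrderAt (iteratedDeriv i f) z ≠ ⊤ := by
  refine meromorphicOrderAt_ne_top_of_not_sameMeromorphic_zero (hf.1.iteratedDeriv i) (fun h => ?_) z
  obtain ⟨Q, hQ⟩ := exists_polynomial_of_iteratedDeriv hf.1 i 0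
    (h.trans (by simp [EventuallyEq]))
  exact hf.2 ⟨Q, 1, one_ne_zero, hQ.trans (by simp [EventuallyEq])⟩

theorem TranscendentalMeromorphic.tendsto_characteristic {f : ℂ → ℂ}
    (hf : TranscendentalMeromorphic f) : Tendsto (characteristic f ⊤) atTop atTop := by
  have h1 : Tendsto (fun r => ‖characteristic f ⊤ r‖) atTop atTop := by
    refine tendsto_atTop_mono' _ (hf.log_isLittleO_characteristic.bound one_pos |>.mono
      fun r hr => ?_) Real.tendsto_log_atTop
    rw [one_mul] at hr
    exact (le_abs_self _).trans hr
  refine h1.congr' ?_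
  filter_upwards [eventually_ge_atTop 1] with r hr
  exact Real.norm_of_nonneg (characteristic_nonneg hr)

/-! ### Calculus of error terms and of terms dominated by `T(r, f)`. -/

/-- The exceptional sets allowed in `IsErrorTerm`. -/
def IsExceptionalSet (E : Set ℝ) : Prop := E ⊆ Set.Ioi 0 ∧ MeasurableSet E ∧ volume E < ⊤

theorem IsExceptionalSet.empty : IsExceptionalSet ∅ := by simp [IsExceptionalSet]

theorem IsExceptionalSet.union {E F : Set ℝ} (hE : IsExceptionalSet E) (hF : IsExceptionalSet F) :
    IsExceptionalSet (E ∪ F) :=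
  ⟨Set.union_subset hE.1 hF.1, hE.2.1.union hF.2.1, measure_union_lt_top hE.2.2 hF.2.2⟩

theorem atTop_inf_principal_compl_mono {E F : Set ℝ} (h : E ⊆ F) :
    (atTop : Filter ℝ) ⊓ 𝓟 Fᶜ ≤ atTop ⊓ 𝓟 Eᶜ :=
  inf_le_inf_left _ (principal_mono.2 (Set.compl_subset_compl.2 h))

theorem IsErrorTerm.add {f : ℂ → ℂ} {s t : ℝ → ℝ} (hs : IsErrorTerm f s) (ht : IsErrorTerm f t) :
    IsErrorTerm f (fun r => s r + t r) := by
  obtain ⟨E, hE0, hEm, hEv, hE⟩ := hs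
  obtain ⟨F, hF0, hFm, hFv, hF⟩ := ht
  obtain ⟨h1, h2, h3⟩ := IsExceptionalSet.union ⟨hE0, hEm, hEv⟩ ⟨hF0, hFm, hFv⟩
  exact ⟨E ∪ F, h1, h2, h3, (hE.mono (atTop_inf_principal_compl_mono Set.subset_union_left)).add
    (hF.mono (atTop_inf_principal_compl_mono Set.subset_union_right))⟩

theorem IsErrorTerm.const_mul {f : ℂ → ℂ} {s : ℝ → ℝ} (hs : IsErrorTerm f s) (c : ℝ) :
    IsErrorTerm f (fun r => c * s r) := by
  obtain ⟨E, hE0, hEm, hEv, hE⟩ := hs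
  exact ⟨E, hE0, hEm, hEv, hE.const_mul_left c⟩

theorem IsErrorTerm.of_le {f : ℂ → ℂ} {s t : ℝ → ℝ} (ht : IsErrorTerm f t) {E : Set ℝ}
    (hE : IsExceptionalSet E) (h : ∀ᶠ r in atTop ⊓ 𝓟 Eᶜ, |s r| ≤ t r) : IsErrorTerm f s := by
  obtain ⟨F, hF0, hFm, hFv, hF⟩ := ht
  obtain ⟨h1, h2, h3⟩ := IsExceptionalSet.union hE ⟨hF0, hFm, hFv⟩
  refine ⟨E ∪ F, h1, h2, h3, IsBigO.trans_isLittleO (IsBigO.of_bound 1 ?_)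
    (hF.mono (atTop_inf_principal_compl_mono Set.subset_union_right))⟩
  filter_upwards [h.filter_mono (atTop_inf_principal_compl_mono Set.subset_union_left)] with r hr
  rw [one_mul]
  exact hr.trans (le_abs_self _)

theorem IsErrorTerm.of_le_of_one_le {f : ℂ → ℂ} {s t : ℝ → ℝ} (ht : IsErrorTerm f t)
    (h : ∀ r, 1 ≤ r → |s r| ≤ t r) : IsErrorTerm f s :=
  ht.of_le IsExceptionalSet.empty
    (((eventually_ge_atTop 1).mono fun r hr => h r hr).filter_mono inf_le_left)

theorem IsErrorTerm.sum {f : ℂ → ℂ} {ι : Type*} (S : Finset ι) {s : ι → ℝ → ℝ}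
    (hs : ∀ i ∈ S, IsErrorTerm f (s i)) : IsErrorTerm f (fun r => ∑ i ∈ S, s i r) := by
  classical
  induction S using Finset.induction_on with
  | empty =>
    simp only [Finset.sum_empty]
    exact ⟨∅, by simp, MeasurableSet.empty, by simp, isLittleO_zero _ _⟩
  | insert i S hi ih =>
    simp only [Finset.sum_insert hi]
    exact (hs i (Finset.mem_insert_self i S)).add
      (ih fun j hj => hs j (Finset.mem_insert_of_mem hj))

theorem IsErrorTerm.of_isLittleO {f : ℂ → ℂ} {s : ℝ → ℝ}
    (hs : s =o[atTop] characteristic f ⊤) : IsErrorTerm f s :=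
  ⟨∅, by simp, MeasurableSet.empty, by simp, hs.mono inf_le_left⟩

theorem TranscendentalMeromorphic.isErrorTerm_const {f : ℂ → ℂ}
    (hf : TranscendentalMeromorphic f) (c : ℝ) : IsErrorTerm f (fun _ => c) :=
  IsErrorTerm.of_isLittleO (Real.isLittleO_const_log_atTop.trans hf.log_isLittleO_characteristic)

/-- The growth of `s` is at most that of the characteristic function of `f`, off an exceptional
set. -/
def IsDominatedTerm (f : ℂ → ℂ) (s : ℝ → ℝ) : Prop :=
  ∃ K : ℝ, ∃ E : Set ℝ, IsExceptionalSet E ∧ ∀ᶠ r in atTop ⊓ 𝓟 Eᶜ, s r ≤ K * characteristic f ⊤ r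

theorem IsDominatedTerm.add {f : ℂ → ℂ} {s t : ℝ → ℝ} (hs : IsDominatedTerm f s)
    (ht : IsDominatedTerm f t) : IsDominatedTerm f (fun r => s r + t r) := by
  obtain ⟨K, E, hE, h1⟩ := hs
  obtain ⟨L, F, hF, h2⟩ := ht
  refine ⟨K + L, E ∪ F, hE.union hF, ?_⟩
  filter_upwards [h1.filter_mono (atTop_inf_principal_compl_mono Set.subset_union_left),
    h2.filter_mono (atTop_inf_principal_compl_mono Set.subset_union_right)] with r hr1 hr2
  linarith

theorem IsDominatedTerm.const_mul {f : ℂ → ℂ} {s : ℝ → ℝ} (hs : IsDominatedTerm f s) {c : ℝ}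
    (hc : 0 ≤ c) : IsDominatedTerm f (fun r => c * s r) := by
  obtain ⟨K, E, hE, h1⟩ := hs
  refine ⟨c * K, E, hE, h1.mono fun r hr => ?_⟩
  rw [mul_assoc]
  exact mul_le_mul_of_nonneg_left hr hc

theorem IsDominatedTerm.of_le_of_one_le {f : ℂ → ℂ} {s t : ℝ → ℝ} (ht : IsDominatedTerm f t)
    (h : ∀ r, 1 ≤ r → s r ≤ t r) : IsDominatedTerm f s := by
  obtain ⟨K, E, hE, h1⟩ := ht
  refine ⟨K, E, hE, ?_⟩
  filter_upwards [h1, (eventually_ge_atTop 1).filter_mono inf_le_left] with r hr1 hr2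
  exact (h r hr2).trans hr1

theorem IsErrorTerm.isDominatedTerm {f : ℂ → ℂ} {s : ℝ → ℝ} (hs : IsErrorTerm f s) :
    IsDominatedTerm f s := by
  obtain ⟨E, hE0, hEm, hEv, hE⟩ := hs
  refine ⟨1, E, ⟨hE0, hEm, hEv⟩, ?_⟩
  filter_upwards [hE.bound one_pos, (eventually_ge_atTop 1).filter_mono inf_le_left] with r hr1 hr2
  rw [Real.norm_of_nonneg (characteristic_nonneg hr2)] at hr1
  exact (le_abs_self _).trans hr1

theorem IsDominatedTerm.self (f : ℂ → ℂ) : IsDominatedTerm f (characteristic f ⊤) :=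
  ⟨1, ∅, IsExceptionalSet.empty, Eventually.of_forall fun r => by rw [one_mul]⟩

/-! ### Proximity and growth of derivatives, quotients and products. -/

/-- The lemma on the logarithmic derivative, for functions growing no faster than `f`. -/
theorem TranscendentalMeromorphic.isErrorTerm_proximity_logDeriv {f h : ℂ → ℂ}
    (hf : TranscendentalMeromorphic f) (hh : Meromorphic h)
    (h0 : ∀ z, meromorphicOrderAt h z ≠ ⊤) (hdom : IsDominatedTerm f (characteristic h ⊤)) :
    IsErrorTerm f (proximity (logDeriv h) ⊤) := by
  obtain ⟨C, E, hE0, hEm, hEv, hE⟩ := exists_proximity_logDeriv_le_log hh h0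
  obtain ⟨K, F, hF, hK⟩ := hdom
  have hlogT : IsErrorTerm f (fun r => Real.log (characteristic f ⊤ r)) :=
    IsErrorTerm.of_isLittleO
      (Real.isLittleO_log_id_atTop.comp_tendsto hf.tendsto_characteristic)
  have ht := ((hf.isErrorTerm_const (C + 8 * Real.log (max K 1))).add
    ((IsErrorTerm.of_isLittleO hf.log_isLittleO_characteristic).const_mul 6)).add
      (hlogT.const_mul 8)
  refine ht.of_le (IsExceptionalSet.union ⟨hE0, hEm, hEv⟩ hF) ?_
  filter_upwards [hK.filter_mono (atTop_inf_principal_compl_mono Set.subset_union_right),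
    (eventually_ge_atTop 1).filter_mono inf_le_left,
    (hf.tendsto_characteristic.eventually_ge_atTop 1).filter_mono inf_le_left,
    (eventually_principal.2 fun r hr => hr : ∀ᶠ r in 𝓟 (E ∪ F)ᶜ, r ∈ (E ∪ F)ᶜ).filter_mono
      inf_le_right] with r hr1 hr2 hr3 hr4
  rw [abs_of_nonneg (proximity_nonneg r)]
  have h1 := hE r hr2 fun h => hr4 (Or.inl h)
  have h2 : max (characteristic h ⊤ r) 1 ≤ max K 1 * characteristic f ⊤ r := by
    refine max_le (hr1.trans ?_) (one_le_mul_of_one_le_of_one_le (le_max_right _ _) hr3)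
    exact mul_le_mul_of_nonneg_right (le_max_left _ _) (by linarith)
  have h3 := Real.log_le_log (by positivity) h2
  rw [Real.log_mul (by positivity) (by positivity)] at h3
  linarith

theorem proximity_le_characteristic {h : ℂ → ℂ} {r : ℝ} (hr : 1 ≤ r) :
    proximity h ⊤ r ≤ characteristic h ⊤ r := by
  have := logCounting_nonneg (f := h) (e := ⊤) hr
  simp only [characteristic, Pi.add_apply]
  linarith

theorem logCounting_le_characteristic {h : ℂ → ℂ} (r : ℝ) :
    logCounting h ⊤ r ≤ characteristic h ⊤ r := by
  have := proximity_nonneg (f := h) (a := ⊤) r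
  simp only [characteristic, Pi.add_apply, Pi.zero_apply] at *
  linarith

theorem IsErrorTerm.abs {f : ℂ → ℂ} {s : ℝ → ℝ} (hs : IsErrorTerm f s) :
    IsErrorTerm f (fun r => |s r|) := by
  obtain ⟨E, hE0, hEm, hEv, hE⟩ := hs
  exact ⟨E, hE0, hEm, hEv, hE.norm_left⟩

theorem TranscendentalMeromorphic.isErrorTerm_characteristic_inv {f b : ℂ → ℂ}
    (hf : TranscendentalMeromorphic f) (hb : Meromorphic b)
    (hT : IsErrorTerm f (characteristic b ⊤)) : IsErrorTerm f (characteristic b⁻¹ ⊤) := by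
  obtain ⟨c, -, hc⟩ := exists_abs_characteristic_sub_inv_le hb
  refine (hT.add (hf.isErrorTerm_const c)).of_le_of_one_le fun r hr => ?_
  rw [abs_of_nonneg (characteristic_nonneg hr)]
  have := abs_le.1 (hc r)
  linarith

theorem TranscendentalMeromorphic.isDominatedTerm_characteristic_inv {f b : ℂ → ℂ}
    (hf : TranscendentalMeromorphic f) (hb : Meromorphic b)
    (hT : IsDominatedTerm f (characteristic b ⊤)) : IsDominatedTerm f (characteristic b⁻¹ ⊤) := by
  obtain ⟨c, -, hc⟩ := exists_abs_characteristic_sub_inv_le hb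
  refine (hT.add (hf.isErrorTerm_const c).isDominatedTerm).of_le_of_one_le fun r _ => ?_
  have := abs_le.1 (hc r)
  linarith

/-- A logarithmic derivative has only simple poles, located at zeros and poles of `h`, where the
right side counts at least one. -/
theorem logCounting_logDeriv_top_le {h : ℂ → ℂ} (hh : Meromorphic h)
    (h0 : ∀ z, meromorphicOrderAt h z ≠ ⊤) {r : ℝ} (hr : 1 ≤ r) :
    logCounting (logDeriv h) ⊤ r ≤ logCounting h ⊤ r + logCounting h 0 r := by
  rw [logCounting_top, logCounting_top, logCounting_zero, ← Pi.add_apply, ← map_add]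
  refine Function.locallyFinsuppWithin.logCounting_le (fun z => ?_) hr
  simp only [Function.locallyFinsuppWithin.negPart_apply,
    Function.locallyFinsuppWithin.posPart_apply, Function.locallyFinsuppWithin.coe_add,
    Pi.add_apply]
  rw [MeromorphicOn.divisor_apply hh.logDeriv.meromorphicOn (Set.mem_univ z),
    MeromorphicOn.divisor_apply hh.meromorphicOn (Set.mem_univ z)]
  obtain ⟨n, hn⟩ := WithTop.ne_top_iff_exists.1 (h0 z)
  rcases eq_or_ne n 0 with rfl | hn0
  · have h1 : 0 ≤ meromorphicOrderAt (logDeriv h) z :=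
      meromorphicOrderAt_logDeriv_nonneg (hh z) hn.symm
    have h2 : 0 ≤ (meromorphicOrderAt (logDeriv h) z).untop₀ := WithTop.untop₀_nonneg.2 h1
    rw [negPart_eq_zero.2 h2]
    exact add_nonneg (negPart_nonneg _) (posPart_nonneg _)
  · have h1 : meromorphicOrderAt (logDeriv h) z = -1 :=
      meromorphicOrderAt_logDeriv_eq_neg_one (hh z) (by rw [← hn]; exact_mod_cast hn0) (h0 z)
    rw [h1, ← hn, WithTop.untop₀_coe]
    have h2 : (-1 : WithTop ℤ).untop₀ = -1 := rfl
    rw [h2, add_comm, posPart_add_negPart]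
    exact Int.one_le_abs hn0

theorem sameMeromorphic_deriv {h : ℂ → ℂ} (hh : Meromorphic h)
    (h0 : ∀ z, meromorphicOrderAt h z ≠ ⊤) : SameMeromorphic (deriv h) (h * logDeriv h) := by
  filter_upwards [(meromorphicOn_univ.2 hh).eventually_codiscreteWithin_apply_ne_zero
    fun z _ => h0 z] with z hz
  rw [Pi.mul_apply, logDeriv_apply, mul_div_cancel₀ _ hz]

/-- From `h' = h · (h'/h)`: the proximity of `h'/h` is an error term, and its poles are counted by
`T(r, h) + T(r, 1/h)`. By iteration the lemma on the logarithmic derivative applies to every `f⁽ⁱ⁾`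
with errors measured against `f`. -/
theorem TranscendentalMeromorphic.isDominatedTerm_deriv {f h : ℂ → ℂ}
    (hf : TranscendentalMeromorphic f) (hh : Meromorphic h)
    (h0 : ∀ z, meromorphicOrderAt (deriv h) z ≠ ⊤)
    (hdom : IsDominatedTerm f (characteristic h ⊤)) :
    IsDominatedTerm f (characteristic (deriv h) ⊤) := by
  have hh0 : ∀ z, meromorphicOrderAt h z ≠ ⊤ := by
    intro z hz
    refine h0 z ?_
    have h1 : h =ᶠ[𝓝[≠] z] 0 := meromorphicOrderAt_eq_top_iff.1 hz
    refine meromorphicOrderAt_eq_top_iff.2 (h1.nhdsNE_deriv.mono fun x hx => ?_)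
    rw [hx]
    exact deriv_const x 0
  have hsame := sameMeromorphic_deriv hh hh0
  have hL0 : ∀ z, meromorphicOrderAt (logDeriv h) z ≠ ⊤ := by
    intro z hz
    refine h0 z ?_
    rw [hsame.meromorphicOrderAt_eq, meromorphicOrderAt_mul (hh z) (hh.logDeriv z), hz]
    simp
  have hlog := (hf.isErrorTerm_proximity_logDeriv hh hh0 hdom).isDominatedTerm
  have hinv := hf.isDominatedTerm_characteristic_inv hh hdom
  refine (((hdom.const_mul zero_le_two).add hinv).add hlog).of_le_of_one_le fun r hr => ?_
  rw [characteristic_congr_codiscrete hsame (by linarith)]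
  refine (characteristic_mul_top_le hr hh hh0 hh.logDeriv hL0).trans ?_
  have h1 := logCounting_logDeriv_top_le hh hh0 hr
  rw [← logCounting_inv (f := h)] at h1
  have h2 := logCounting_le_characteristic (h := h) r
  have h3 := logCounting_le_characteristic (h := h⁻¹) r
  have h4 : characteristic (logDeriv h) ⊤ r =
    proximity (logDeriv h) ⊤ r + logCounting (logDeriv h) ⊤ r := rfl
  rw [Pi.add_apply, h4]
  linarith

theorem TranscendentalMeromorphic.isDominatedTerm_iteratedDeriv {f : ℂ → ℂ}
    (hf : TranscendentalMeromorphic f) (i : ℕ) :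
    IsDominatedTerm f (characteristic (iteratedDeriv i f) ⊤) := by
  induction i with
  | zero => rw [iteratedDeriv_zero]; exact IsDominatedTerm.self f
  | succ i ih =>
    have h1 := hf.meromorphicOrderAt_iteratedDeriv_ne_top (i + 1)
    rw [iteratedDeriv_succ] at h1 ⊢
    exact hf.isDominatedTerm_deriv (hf.1.iteratedDeriv i) h1 ih

/-- The quotient telescopes into logarithmic derivatives: `f⁽ⁱ⁺¹⁾/f = (f⁽ⁱ⁺¹⁾/f⁽ⁱ⁾) · (f⁽ⁱ⁾/f)`. -/
theorem TranscendentalMeromorphic.isErrorTerm_proximity_iteratedDeriv_div {f : ℂ → ℂ}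
    (hf : TranscendentalMeromorphic f) (i : ℕ) :
    IsErrorTerm f (proximity (iteratedDeriv i f / f) ⊤) := by
  induction i with
  | zero =>
    refine (hf.isErrorTerm_const 0).of_le_of_one_le fun r hr => le_of_eq ?_
    have hsame : SameMeromorphic (iteratedDeriv 0 f / f) (fun _ => 1) := by
      filter_upwards [(meromorphicOn_univ.2 hf.1).eventually_codiscreteWithin_apply_ne_zero
        fun z _ => hf.meromorphicOrderAt_ne_top z] with z hz
      rw [iteratedDeriv_zero, Pi.div_apply, div_self hz]
    rw [proximity_congr_codiscrete hsame (by linarith), proximity_const]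
    simp
  | succ i ih =>
    have hi := hf.1.iteratedDeriv i
    have hi0 := hf.meromorphicOrderAt_iteratedDeriv_ne_top i
    have hlog := hf.isErrorTerm_proximity_logDeriv hi hi0 (hf.isDominatedTerm_iteratedDeriv i)
    refine (hlog.add ih).of_le_of_one_le fun r hr => ?_
    rw [abs_of_nonneg (proximity_nonneg r)]
    have hsame : SameMeromorphic (iteratedDeriv (i + 1) f / f)
        (logDeriv (iteratedDeriv i f) * (iteratedDeriv i f / f)) := by
      filter_upwards [sameMeromorphic_deriv hi hi0] with z hz
      rw [iteratedDeriv_succ, Pi.div_apply, hz, Pi.mul_apply, Pi.mul_apply, Pi.div_apply]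
      ring
    rw [proximity_congr_codiscrete hsame (by linarith)]
    exact proximity_mul_top_le hi.logDeriv (hi.div hf.1) r

theorem proximity_prod_pow_top_le {ι : Type*} (S : Finset ι) {F : ι → ℂ → ℂ} (n : ι → ℕ)
    (hF : ∀ i ∈ S, Meromorphic (F i)) (r : ℝ) :
    proximity (∏ i ∈ S, F i ^ n i) ⊤ r ≤ ∑ i ∈ S, n i * proximity (F i) ⊤ r := by
  classical
  induction S using Finset.induction_on with
  | empty =>
    have : (1 : ℂ → ℂ) = fun _ => 1 := rfl
    rw [Finset.prod_empty, Finset.sum_empty, this, proximity_const]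
    simp
  | insert i S hi ih =>
    have h1 := hF i (Finset.mem_insert_self i S)
    have h2 : ∀ j ∈ S, Meromorphic (F j) := fun j hj => hF j (Finset.mem_insert_of_mem hj)
    rw [Finset.prod_insert hi, Finset.sum_insert hi]
    refine (proximity_mul_top_le (fun z => (h1 z).pow _) (fun z => MeromorphicAt.prod fun j hj =>
      (h2 j hj z).pow _) r).trans ?_
    rw [Pi.add_apply, proximity_pow_top]
    refine add_le_add (le_of_eq ?_) (ih h2)
    simp

theorem meromorphicOrderAt_mul_ne_top {f g : ℂ → ℂ} {z : ℂ} (hf : MeromorphicAt f z)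
    (hg : MeromorphicAt g z) (hf0 : meromorphicOrderAt f z ≠ ⊤)
    (hg0 : meromorphicOrderAt g z ≠ ⊤) : meromorphicOrderAt (f * g) z ≠ ⊤ := by
  rw [meromorphicOrderAt_mul hf hg]
  exact WithTop.add_ne_top.2 ⟨hf0, hg0⟩

theorem meromorphicOrderAt_pow_ne_top {f : ℂ → ℂ} {z : ℂ} (hf : MeromorphicAt f z)
    (hf0 : meromorphicOrderAt f z ≠ ⊤) (n : ℕ) : meromorphicOrderAt (f ^ n) z ≠ ⊤ := by
  induction n with
  | zero =>
    rw [pow_zero]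
    have : (1 : ℂ → ℂ) = fun _ => 1 := rfl
    classical
    rw [this, meromorphicOrderAt_const]
    simp
  | succ n ih =>
    rw [pow_succ]
    exact meromorphicOrderAt_mul_ne_top (hf.pow n) hf ih hf0

theorem meromorphicOrderAt_prod_pow_ne_top {ι : Type*} (S : Finset ι) {F : ι → ℂ → ℂ} (n : ι → ℕ)
    {z : ℂ} (hF : ∀ i ∈ S, MeromorphicAt (F i) z)
    (hF0 : ∀ i ∈ S, meromorphicOrderAt (F i) z ≠ ⊤) :
    meromorphicOrderAt (∏ i ∈ S, F i ^ n i) z ≠ ⊤ := by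
  rw [meromorphicOrderAt_prod fun i hi => (hF i hi).pow _]
  exact WithTop.sum_ne_top.2 fun i hi => meromorphicOrderAt_pow_ne_top (hF i hi) (hF0 i hi) _

theorem IsDominatedTerm.prod_pow {f : ℂ → ℂ} {ι : Type*} (S : Finset ι) {F : ι → ℂ → ℂ}
    (n : ι → ℕ) (hf : TranscendentalMeromorphic f) (hF : ∀ i ∈ S, Meromorphic (F i))
    (hF0 : ∀ i ∈ S, ∀ z, meromorphicOrderAt (F i) z ≠ ⊤)
    (hdom : ∀ i ∈ S, IsDominatedTerm f (characteristic (F i) ⊤)) :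
    IsDominatedTerm f (characteristic (∏ i ∈ S, F i ^ n i) ⊤) := by
  classical
  induction S using Finset.induction_on with
  | empty =>
    have : (1 : ℂ → ℂ) = fun _ => 1 := rfl
    refine (hf.isErrorTerm_const 0).isDominatedTerm.of_le_of_one_le fun r _ => le_of_eq ?_
    rw [Finset.prod_empty, this, characteristic, Pi.add_apply, proximity_const, logCounting_const]
    simp
  | insert i S hi ih =>
    have h1 := hF i (Finset.mem_insert_self i S)
    have h1' := hF0 i (Finset.mem_insert_self i S)
    have h2 : ∀ j ∈ S, Meromorphic (F j) := fun j hj => hF j (Finset.mem_insert_of_mem hj)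
    have h2' : ∀ j ∈ S, ∀ z, meromorphicOrderAt (F j) z ≠ ⊤ := fun j hj =>
      hF0 j (Finset.mem_insert_of_mem hj)
    rw [Finset.prod_insert hi]
    refine (((hdom i (Finset.mem_insert_self i S)).const_mul (Nat.cast_nonneg (n i))).add
      (ih h2 h2' fun j hj => hdom j (Finset.mem_insert_of_mem hj))).of_le_of_one_le fun r hr => ?_
    refine (characteristic_mul_top_le hr (fun z => (h1 z).pow _)
      (fun z => meromorphicOrderAt_pow_ne_top (h1 z) (h1' z) _)
      (fun z => MeromorphicAt.prod fun j hj => (h2 j hj z).pow _)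
      (fun z => meromorphicOrderAt_prod_pow_ne_top S n (fun j hj => h2 j hj z)
        fun j hj => h2' j hj z)).trans ?_
    rw [Pi.add_apply, characteristic_pow_top h1]
    simp

/-! ### Local comparison of zeros and poles. -/

theorem meromorphicOrderAt_deriv_nonneg {h : ℂ → ℂ} {z : ℂ} (hh : MeromorphicAt h z)
    (h0 : 0 ≤ meromorphicOrderAt h z) : 0 ≤ meromorphicOrderAt (deriv h) z := by
  obtain ⟨F, hF, hhF⟩ := hh.meromorphicOrderAt_nonneg_iff.1 h0
  exact hh.deriv.meromorphicOrderAt_nonneg_iff.2 ⟨deriv F, hF.deriv, hhF.nhdsNE_deriv⟩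

theorem meromorphicOrderAt_iteratedDeriv_nonneg {h : ℂ → ℂ} {z : ℂ} (hh : Meromorphic h)
    (h0 : 0 ≤ meromorphicOrderAt h z) (i : ℕ) : 0 ≤ meromorphicOrderAt (iteratedDeriv i h) z := by
  induction i with
  | zero => rwa [iteratedDeriv_zero]
  | succ i ih =>
    rw [iteratedDeriv_succ]
    exact meromorphicOrderAt_deriv_nonneg (hh.iteratedDeriv i z) ih

theorem meromorphicOrderAt_sub_const_ne_top {g : ℂ → ℂ} {z : ℂ}
    (h' : meromorphicOrderAt (deriv g) z ≠ ⊤) (c : ℂ) :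
    meromorphicOrderAt (fun w => g w - c) z ≠ ⊤ := by
  intro htop
  refine h' (meromorphicOrderAt_eq_top_iff.2 ?_)
  have h1 : (fun w => g w - c) =ᶠ[𝓝[≠] z] fun _ => 0 := meromorphicOrderAt_eq_top_iff.1 htop
  refine h1.nhdsNE_deriv.mono fun w hw => ?_
  rw [deriv_sub_const] at hw
  rw [hw, deriv_const]

theorem neg_one_le_untop_meromorphicOrderAt_logDeriv {h : ℂ → ℂ} {z : ℂ} (hh : MeromorphicAt h z)
    (h0 : meromorphicOrderAt h z ≠ ⊤) : -1 ≤ (meromorphicOrderAt (logDeriv h) z).untop₀ := by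
  rcases eq_or_ne (meromorphicOrderAt h z) 0 with h1 | h1
  · have := WithTop.untop₀_nonneg.2 (meromorphicOrderAt_logDeriv_nonneg hh h1)
    linarith
  · rw [meromorphicOrderAt_logDeriv_eq_neg_one hh h1 h0]
    exact le_of_eq rfl

/-- Where `g` vanishes to order `n`, the logarithmic derivative of `g - 1` vanishes to order
`n - 1`. -/
theorem meromorphicOrderAt_sub_one_of_pos {g : ℂ → ℂ} {z : ℂ} (hg : MeromorphicAt g z) {n : ℤ}
    (hn : meromorphicOrderAt g z = n) (hpos : 0 < n) :
    meromorphicOrderAt (fun w => g w - 1) z = 0 ∧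
      meromorphicOrderAt (logDeriv fun w => g w - 1) z = ((n - 1 : ℤ) : WithTop ℤ) := by
  classical
  have h1 : meromorphicOrderAt (fun w => g w - 1) z = 0 := by
    have h2 : meromorphicOrderAt (fun _ : ℂ => (-1 : ℂ)) z = 0 := by
      rw [meromorphicOrderAt_const]; simp
    have h3 : (fun w => g w - 1) = g + fun _ => (-1 : ℂ) := by ext w; simp [sub_eq_add_neg]
    rw [h3, meromorphicOrderAt_add_eq_right_of_lt hg (by rw [h2, hn]; exact_mod_cast hpos), h2]
  refine ⟨h1, ?_⟩
  have hG : MeromorphicAt (fun w => g w - 1) z := hg.sub (MeromorphicAt.const 1 z)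
  have h4 : deriv (fun w => g w - 1) = deriv g := by ext w; exact deriv_sub_const (1 : ℂ)
  rw [logDeriv, meromorphicOrderAt_div hG.deriv hG, h1, h4,
    meromorphicOrderAt_deriv_eq_sub_one (Int.cast_ne_zero.2 hpos.ne') hn, sub_zero]

theorem min_untop_le_untop_meromorphicOrderAt_sub_one {g : ℂ → ℂ} {z : ℂ} (hg : MeromorphicAt g z)
    (h0 : meromorphicOrderAt g z ≠ ⊤) (h1 : meromorphicOrderAt (fun w => g w - 1) z ≠ ⊤) :
    min (meromorphicOrderAt g z).untop₀ 0 ≤ (meromorphicOrderAt (fun w => g w - 1) z).untop₀ := by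
  classical
  have h2 : meromorphicOrderAt (fun _ : ℂ => (-1 : ℂ)) z = 0 := by
    rw [meromorphicOrderAt_const]; simp
  have h3 : (fun w => g w - 1) = g + fun _ => (-1 : ℂ) := by ext w; simp [sub_eq_add_neg]
  have h4 := meromorphicOrderAt_add hg (MeromorphicAt.const (-1 : ℂ) z)
  rw [← h3, h2] at h4
  obtain ⟨n, hn⟩ := WithTop.ne_top_iff_exists.1 h0
  obtain ⟨m, hm⟩ := WithTop.ne_top_iff_exists.1 h1
  rw [← hn, ← hm] at h4 ⊢
  rw [WithTop.untop₀_coe, WithTop.untop₀_coe]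
  exact_mod_cast h4

/-- The arithmetic of orders at one point: `p, α, β, γ, δ, m` are the orders of `f, a, φ, g, g - 1,
M[f] - φ`, and `ν` is minus the order of `L = (g - 1)'/(g - 1)`. At a pole of `f`, `l ν ≤ l ≤ -p`.
At a zero of `f` where `g` vanishes, the order of `L` is at least `q p - 1 + α - β`. Elsewhere a
pole of `L` requires `δ ≠ 0` or a contribution from `a` and `φ`. -/
theorem int_order_inequality {p α β γ δ m ν q l : ℤ} (hl : 1 ≤ l)
    (hp : p < 0 → p ≤ -l) (hν : ν ≤ 1) (hν0 : δ = 0 → ν ≤ 0)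
    (hγ : 0 < γ → δ = 0 ∧ ν ≤ 1 - γ) (hδ : min γ 0 ≤ δ) (hm : m = δ + β)
    (hpγ : 0 ≤ p → q * p + α - β ≤ γ) :
    l * ((q - 1) * p⁺ + ν) ≤ p⁻ + l * (m⁺ + |α| + |β|) := by
  have hm0 : 0 ≤ m⁺ := posPart_nonneg m
  have hm1 : m ≤ m⁺ := le_posPart m
  have hα := abs_nonneg α
  have hβ := abs_nonneg β
  have hα' := neg_abs_le α
  have hβ' := le_abs_self β
  have hβ'' := neg_abs_le β
  rcases lt_or_ge p 0 with hp0 | hp0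
  · rw [posPart_eq_zero.2 hp0.le, negPart_of_nonpos hp0.le, mul_zero, zero_add]
    have h1 : l * ν ≤ l * 1 := mul_le_mul_of_nonneg_left hν (by linarith)
    have h2 : 0 ≤ l * (m⁺ + |α| + |β|) := by positivity
    linarith [hp hp0]
  · rw [posPart_of_nonneg hp0, negPart_eq_zero.2 hp0, zero_add]
    refine mul_le_mul_of_nonneg_left ?_ (by linarith)
    have h1 := hpγ hp0
    rcases lt_or_ge 0 γ with hγ0 | hγ0
    · obtain ⟨hδ0, h2⟩ := hγ hγ0
      rcases hp0.eq_or_lt with rfl | hp1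
      · have := hν0 hδ0
        simp only [mul_zero, zero_add]
        linarith
      · nlinarith
    · rcases hp0.eq_or_lt with rfl | hp1
      · simp only [mul_zero, zero_add] at h1 ⊢
        rcases eq_or_ne δ 0 with hδ0 | hδ0
        · have := hν0 hδ0
          linarith
        -- If `δ < 0`, then `g` has a pole although `f` does not, so `α - β < 0` and `a` or `φ` pays
        -- for `ν ≤ 1`. If `δ > 0`, then `m = δ + β` and a zero of `M[f] - φ` or a pole of `φ` pays.
        · rcases lt_or_gt_of_ne hδ0 with h2 | h2
          · rw [min_eq_left hγ0] at hδ
            have : 1 ≤ |α| + |β| := by linarith [Int.add_one_le_iff.2 h2]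
            linarith
          · linarith [Int.add_one_le_iff.2 h2]
      · nlinarith

theorem diffMonomial_eq (a : ℂ → ℂ) (k : ℕ) (q : ℕ → ℕ) (f : ℂ → ℂ) :
    diffMonomial a k q f = a * ∏ i ∈ Finset.range (k + 1), iteratedDeriv i f ^ q i := by
  ext z
  simp [diffMonomial, Finset.prod_apply]

theorem meromorphic_prod_iteratedDeriv_pow {f : ℂ → ℂ} (hf : Meromorphic f) (k : ℕ) (q : ℕ → ℕ) :
    Meromorphic (∏ i ∈ Finset.range (k + 1), iteratedDeriv i f ^ q i) := fun z =>
  MeromorphicAt.prod fun i _ => (hf.iteratedDeriv i z).pow _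

/-- Away from poles of `f` every derivative has nonnegative order, so the factor `f ^ q 0` alone
bounds the order from below. -/
theorem mul_meromorphicOrderAt_le_prod_iteratedDeriv_pow {f : ℂ → ℂ} (hf : Meromorphic f) (k : ℕ)
    (q : ℕ → ℕ) {z : ℂ} (h0 : 0 ≤ meromorphicOrderAt f z) :
    q 0 * meromorphicOrderAt f z ≤
      meromorphicOrderAt (∏ i ∈ Finset.range (k + 1), iteratedDeriv i f ^ q i) z := by
  rw [meromorphicOrderAt_prod fun i _ => (hf.iteratedDeriv i z).pow _]
  have h1 : q 0 * meromorphicOrderAt f z = meromorphicOrderAt (iteratedDeriv 0 f ^ q 0) z := by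
    rw [meromorphicOrderAt_pow (hf.iteratedDeriv 0 z), iteratedDeriv_zero]
  rw [h1]
  refine Finset.single_le_sum (f := fun i => meromorphicOrderAt (iteratedDeriv i f ^ q i) z)
    (fun i _ => ?_) (Finset.mem_range.2 (Nat.succ_pos k))
  have h2 := hf.iteratedDeriv i z
  obtain ⟨F, hF, hfF⟩ := h2.meromorphicOrderAt_nonneg_iff.1
    (meromorphicOrderAt_iteratedDeriv_nonneg hf h0 i)
  exact (h2.pow (q i)).meromorphicOrderAt_nonneg_iff.2 ⟨F ^ q i, hF.pow _, hfF.pow_const _⟩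

theorem untop_meromorphicOrderAt_mul {f g : ℂ → ℂ} {z : ℂ} (hf : MeromorphicAt f z)
    (hg : MeromorphicAt g z) (hf0 : meromorphicOrderAt f z ≠ ⊤)
    (hg0 : meromorphicOrderAt g z ≠ ⊤) :
    (meromorphicOrderAt (f * g) z).untop₀ =
      (meromorphicOrderAt f z).untop₀ + (meromorphicOrderAt g z).untop₀ := by
  rw [meromorphicOrderAt_mul hf hg]
  exact WithTop.untop₀_add hf0 hg0

theorem untop_meromorphicOrderAt_inv (f : ℂ → ℂ) (z : ℂ) :
    (meromorphicOrderAt f⁻¹ z).untop₀ = -(meromorphicOrderAt f z).untop₀ := by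
  rw [meromorphicOrderAt_inv, WithTop.untop₀_neg]

/-- Lower bound for the order of `M[f] / φ` at a point that is not a pole of `f`. -/
theorem le_untop_meromorphicOrderAt_diffMonomial_div {f a φ : ℂ → ℂ}
    (hf : TranscendentalMeromorphic f) (ha : Meromorphic a) (hφ : Meromorphic φ)
    (ha0 : ∀ z, meromorphicOrderAt a z ≠ ⊤) (hφ0 : ∀ z, meromorphicOrderAt φ z ≠ ⊤) (k : ℕ)
    (q : ℕ → ℕ) {z : ℂ} (h0 : 0 ≤ (meromorphicOrderAt f z).untop₀) :
    q 0 * (meromorphicOrderAt f z).untop₀ + (meromorphicOrderAt a z).untop₀ -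
      (meromorphicOrderAt φ z).untop₀ ≤
        (meromorphicOrderAt (diffMonomial a k q f * φ⁻¹) z).untop₀ := by
  have hP := meromorphic_prod_iteratedDeriv_pow hf.1 k q
  have hP0 : meromorphicOrderAt (∏ i ∈ Finset.range (k + 1), iteratedDeriv i f ^ q i) z ≠ ⊤ :=
    meromorphicOrderAt_prod_pow_ne_top _ _ (fun i _ => hf.1.iteratedDeriv i z)
      fun i _ => hf.meromorphicOrderAt_iteratedDeriv_ne_top i z
  have hφi0 : meromorphicOrderAt φ⁻¹ z ≠ ⊤ := by
    rw [meromorphicOrderAt_inv]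
    simpa using hφ0 z
  have h1 := mul_meromorphicOrderAt_le_prod_iteratedDeriv_pow hf.1 k q
    (WithTop.untop₀_nonneg.1 h0)
  obtain ⟨p, hp⟩ := WithTop.ne_top_iff_exists.1 (hf.meromorphicOrderAt_ne_top z)
  obtain ⟨n, hn⟩ := WithTop.ne_top_iff_exists.1 hP0
  rw [diffMonomial_eq, untop_meromorphicOrderAt_mul ((ha z).mul (hP z)) (hφ z).inv
    (meromorphicOrderAt_mul_ne_top (ha z) (hP z) (ha0 z) hP0) hφi0,
    untop_meromorphicOrderAt_mul (ha z) (hP z) (ha0 z) hP0, untop_meromorphicOrderAt_inv]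
  rw [← hp, ← hn] at h1
  rw [← hp, ← hn, WithTop.untop₀_coe, WithTop.untop₀_coe]
  have h2 : (q 0 : ℤ) * p ≤ n := by exact_mod_cast h1
  linarith

/-- The pointwise comparison of zeros and poles behind the main estimate. -/
theorem divisor_logDeriv_inequality {f a φ : ℂ → ℂ} {l : ℕ} (hf : TranscendentalMeromorphic f)
    (ha : Meromorphic a) (hφ : Meromorphic φ) (ha0 : ∀ z, meromorphicOrderAt a z ≠ ⊤)
    (hφ0 : ∀ z, meromorphicOrderAt φ z ≠ ⊤) (k : ℕ) (q : ℕ → ℕ) (hl : 1 ≤ l)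
    (hpoles : PolesMultiplicityGe f l)
    (hM : Meromorphic (diffMonomial a k q f * φ⁻¹))
    (hM0 : ∀ z, meromorphicOrderAt (diffMonomial a k q f * φ⁻¹) z ≠ ⊤)
    (hM' : ∀ z, meromorphicOrderAt (deriv (diffMonomial a k q f * φ⁻¹)) z ≠ ⊤) :
    l • (((q 0 : ℤ) - 1) • (MeromorphicOn.divisor f Set.univ)⁺ -
        MeromorphicOn.divisor
          (logDeriv fun w => (diffMonomial a k q f * φ⁻¹) w - 1) Set.univ) ≤
      (MeromorphicOn.divisor f Set.univ)⁻ +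
        l • ((MeromorphicOn.divisor (fun z => diffMonomial a k q f z - φ z) Set.univ)⁺ +
          ((MeromorphicOn.divisor a Set.univ)⁺ + (MeromorphicOn.divisor a Set.univ)⁻) +
          ((MeromorphicOn.divisor φ Set.univ)⁺ + (MeromorphicOn.divisor φ Set.univ)⁻)) := by
  set g := diffMonomial a k q f * φ⁻¹ with hg
  set G : ℂ → ℂ := fun w => g w - 1 with hGdef
  have hG : Meromorphic G := fun z => (hM z).sub (MeromorphicAt.const 1 z)
  have hG0 : ∀ z, meromorphicOrderAt G z ≠ ⊤ := fun z =>
    meromorphicOrderAt_sub_const_ne_top (hM' z) 1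
  -- The relation `M[f] - φ = (g - 1) φ` ties the zeros of `g - 1` to those counted in the theorem.
  have hsame : SameMeromorphic (fun z => diffMonomial a k q f z - φ z) (G * φ) := by
    filter_upwards [(meromorphicOn_univ.2 hφ).eventually_codiscreteWithin_apply_ne_zero
      fun z _ => hφ0 z] with z hz
    simp only [hGdef, hg, Pi.mul_apply, Pi.inv_apply]
    field_simp
  have hMφ : Meromorphic (fun z => diffMonomial a k q f z - φ z) := fun z =>
    ((hG z).mul (hφ z)).congr (sameMeromorphic_iff.1 hsame z).symm
  intro z
  simp only [Function.locallyFinsuppWithin.coe_nsmul, Function.locallyFinsuppWithin.coe_zsmul,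
    Function.locallyFinsuppWithin.coe_add, Function.locallyFinsuppWithin.coe_sub, Pi.add_apply,
    Pi.sub_apply, Pi.smul_apply, Function.locallyFinsuppWithin.negPart_apply,
    Function.locallyFinsuppWithin.posPart_apply]
  simp only [posPart_add_negPart, smul_eq_mul, nsmul_eq_mul]
  rw [MeromorphicOn.divisor_apply hf.1.meromorphicOn (Set.mem_univ z),
    MeromorphicOn.divisor_apply ha.meromorphicOn (Set.mem_univ z),
    MeromorphicOn.divisor_apply hφ.meromorphicOn (Set.mem_univ z),
    MeromorphicOn.divisor_apply hG.logDeriv.meromorphicOn (Set.mem_univ z),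
    MeromorphicOn.divisor_apply hMφ.meromorphicOn (Set.mem_univ z), sub_eq_add_neg]
  refine int_order_inequality (γ := (meromorphicOrderAt g z).untop₀)
    (δ := (meromorphicOrderAt G z).untop₀) (by exact_mod_cast hl) ?_ ?_ ?_ ?_ ?_ ?_ ?_
  · intro hp
    obtain ⟨p, hp'⟩ := WithTop.ne_top_iff_exists.1 (hf.meromorphicOrderAt_ne_top z)
    have h1 := hpoles z
    rw [← hp'] at h1 hp ⊢
    rw [WithTop.untop₀_coe] at hp ⊢
    exact_mod_cast h1 (by exact_mod_cast hp)
  · have := neg_one_le_untop_meromorphicOrderAt_logDeriv (hG z) (hG0 z)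
    linarith
  · intro hδ
    have h1 : meromorphicOrderAt G z = 0 := by
      rcases WithTop.untop₀_eq_zero.1 hδ with h | h
      · exact h
      · exact absurd h (hG0 z)
    have := WithTop.untop₀_nonneg.2 (meromorphicOrderAt_logDeriv_nonneg (hG z) h1)
    linarith
  · intro hγ
    obtain ⟨h1, h2⟩ := meromorphicOrderAt_sub_one_of_pos (hM z)
      (WithTop.coe_untop₀_of_ne_top (hM0 z)).symm hγ
    rw [h1, h2, WithTop.untop₀_coe]
    exact ⟨rfl, by linarith⟩
  · exact min_untop_le_untop_meromorphicOrderAt_sub_one (hM z) (hM0 z) (hG0 z)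
  · rw [hsame.meromorphicOrderAt_eq]
    exact untop_meromorphicOrderAt_mul (hG z) (hφ z) (hG0 z) (hφ0 z)
  · exact le_untop_meromorphicOrderAt_diffMonomial_div hf ha hφ ha0 hφ0 k q

/-- The counting function is additive in the divisor and monotone for `r ≥ 1`, so the pointwise
inequality integrates directly. -/
theorem logCounting_logDeriv_inequality {f a φ : ℂ → ℂ} {l : ℕ} (hf : TranscendentalMeromorphic f)
    (ha : Meromorphic a) (hφ : Meromorphic φ) (ha0 : ∀ z, meromorphicOrderAt a z ≠ ⊤)
    (hφ0 : ∀ z, meromorphicOrderAt φ z ≠ ⊤) (k : ℕ) (q : ℕ → ℕ) (hl : 1 ≤ l)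
    (hpoles : PolesMultiplicityGe f l)
    (hM : Meromorphic (diffMonomial a k q f * φ⁻¹))
    (hM0 : ∀ z, meromorphicOrderAt (diffMonomial a k q f * φ⁻¹) z ≠ ⊤)
    (hM' : ∀ z, meromorphicOrderAt (deriv (diffMonomial a k q f * φ⁻¹)) z ≠ ⊤)
    {r : ℝ} (hr : 1 ≤ r) :
    l * (((q 0 : ℝ) - 1) * logCounting f 0 r +
        (logCounting (logDeriv fun w => (diffMonomial a k q f * φ⁻¹) w - 1) ⊤ r -
          logCounting (logDeriv fun w => (diffMonomial a k q f * φ⁻¹) w - 1) 0 r)) ≤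
      logCounting f ⊤ r +
        l * (logCounting (fun z => (diffMonomial a k q f z - φ z)⁻¹) ⊤ r +
          (logCounting a 0 r + logCounting a ⊤ r) + (logCounting φ 0 r + logCounting φ ⊤ r)) := by
  have h1 := Function.locallyFinsuppWithin.logCounting_le
    (divisor_logDeriv_inequality hf ha hφ ha0 hφ0 k q hl hpoles hM hM0 hM') hr
  have h2 : logCounting (fun z => (diffMonomial a k q f z - φ z)⁻¹) ⊤ =
      logCounting (fun z => diffMonomial a k q f z - φ z) 0 :=
    logCounting_inv (f := fun z => diffMonomial a k q f z - φ z)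
  rw [h2]
  simp only [map_nsmul, map_add, map_sub, map_zsmul, ← logCounting_zero, ← logCounting_top,
    log_counting_zero_sub_logCounting_top, Pi.add_apply, Pi.sub_apply, Pi.smul_apply] at h1
  simp only [nsmul_eq_mul, zsmul_eq_mul] at h1
  push_cast at h1
  linarith

/-! ### Estimates of `m(r, 1/f)`. -/

/-- The quotient `M[f] / (φ f ^ d)`, written through the quotients `f⁽ⁱ⁾ / f`. -/
theorem TranscendentalMeromorphic.isErrorTerm_proximity_monomial {f a φ : ℂ → ℂ}
    (hf : TranscendentalMeromorphic f) (ha : IsSmallFunction a f) (hφ : IsSmallFunction φ f)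
    (k : ℕ) (q : ℕ → ℕ) :
    IsErrorTerm f (proximity (a * φ⁻¹ *
      ∏ i ∈ Finset.range (k + 1), (iteratedDeriv i f / f) ^ q i) ⊤) := by
  have hF : ∀ i, Meromorphic (iteratedDeriv i f / f) := fun i => (hf.1.iteratedDeriv i).div hf.1
  have hφi := hf.isErrorTerm_characteristic_inv hφ.1 hφ.2.2
  refine ((ha.2.2.add hφi).add (IsErrorTerm.sum (Finset.range (k + 1)) fun i _ =>
    (hf.isErrorTerm_proximity_iteratedDeriv_div i).const_mul (q i))).of_le_of_one_le
      fun r hr => ?_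
  rw [abs_of_nonneg (proximity_nonneg r)]
  have h1 := proximity_mul_top_le (ha.1.mul hφ.1.inv)
    (fun z => MeromorphicAt.prod fun i (_ : i ∈ Finset.range (k + 1)) => (hF i z).pow (q i)) r
  have h2 := proximity_mul_top_le ha.1 hφ.1.inv r
  have h3 := proximity_prod_pow_top_le (Finset.range (k + 1)) q (fun i _ => hF i) r
  have h4 := proximity_le_characteristic (h := a) hr
  have h5 := proximity_le_characteristic (h := φ⁻¹) hr
  simp only [Pi.add_apply] at h1 h2
  linarith

theorem monomial_div_pow_eq (f a φ : ℂ → ℂ) (k : ℕ) (q : ℕ → ℕ) :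
    a * φ⁻¹ * ∏ i ∈ Finset.range (k + 1), (iteratedDeriv i f / f) ^ q i =
      diffMonomial a k q f * φ⁻¹ * f⁻¹ ^ (∑ i ∈ Finset.range (k + 1), q i) := by
  rw [diffMonomial_eq]
  simp only [div_pow, Finset.prod_div_distrib, Finset.prod_pow_eq_pow_sum]
  rw [inv_pow, div_eq_mul_inv]
  ring

/-- The estimate of `m(r, 1/f)` when `M[f] / φ` is not constant. -/
theorem exists_proximity_inv_le {f a φ : ℂ → ℂ} (hf : TranscendentalMeromorphic f)
    (ha : IsSmallFunction a f) (hφ : IsSmallFunction φ f) (k : ℕ) (q : ℕ → ℕ)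
    (hM : Meromorphic (diffMonomial a k q f * φ⁻¹))
    (hM0 : ∀ z, meromorphicOrderAt (diffMonomial a k q f * φ⁻¹) z ≠ ⊤)
    (hM' : ∀ z, meromorphicOrderAt (deriv (diffMonomial a k q f * φ⁻¹)) z ≠ ⊤)
    (hdom : IsDominatedTerm f (characteristic (diffMonomial a k q f * φ⁻¹) ⊤)) :
    ∃ s : ℝ → ℝ, IsErrorTerm f s ∧ ∀ r, 1 ≤ r →
      (∑ i ∈ Finset.range (k + 1), q i : ℕ) * proximity f⁻¹ ⊤ r ≤ s r +
        (logCounting (logDeriv fun w => (diffMonomial a k q f * φ⁻¹) w - 1) ⊤ r -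
          logCounting (logDeriv fun w => (diffMonomial a k q f * φ⁻¹) w - 1) 0 r) := by
  set g := diffMonomial a k q f * φ⁻¹ with hg
  set G : ℂ → ℂ := fun w => g w - 1 with hGdef
  set d := ∑ i ∈ Finset.range (k + 1), q i with hd
  have hG : Meromorphic G := fun z => (hM z).sub (MeromorphicAt.const 1 z)
  have hG0 : ∀ z, meromorphicOrderAt G z ≠ ⊤ := fun z =>
    meromorphicOrderAt_sub_const_ne_top (hM' z) 1
  have hG' : deriv G = deriv g := by ext w; exact deriv_sub_const (1 : ℂ)
  have hGdom : IsDominatedTerm f (characteristic G ⊤) := by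
    refine (hdom.add (hf.isErrorTerm_const
      (Real.posLog ‖(1 : ℂ)‖ + Real.log 2)).isDominatedTerm).of_le_of_one_le fun r _ => ?_
    have := abs_le.1 (abs_characteristic_sub_characteristic_shift_le (r := r) (a₀ := 1) hM)
    linarith
  set W := a * φ⁻¹ * ∏ i ∈ Finset.range (k + 1), (iteratedDeriv i f / f) ^ q i with hW
  have hWm : Meromorphic W := by
    rw [hW, monomial_div_pow_eq]
    exact hM.mul fun z => (hf.1 z).inv.pow _
  have hWg : W = g * f⁻¹ ^ d := monomial_div_pow_eq f a φ k q
  have hWerr : IsErrorTerm f (proximity W ⊤) := hf.isErrorTerm_proximity_monomial ha hφ k q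
  obtain ⟨c, hc0, hc⟩ := exists_abs_characteristic_sub_inv_le hG.logDeriv
  -- The quotient `(g'/g) / (G'/G)` equals `(g - 1)/g`, so the right side is `W (1 - (g - 1)/g) =
  -- W/g`.
  have hident : SameMeromorphic (f⁻¹ ^ d) (W + -(logDeriv g * (W * (logDeriv G)⁻¹))) := by
    filter_upwards [(meromorphicOn_univ.2 hM).eventually_codiscreteWithin_apply_ne_zero
      fun z _ => hM0 z, (meromorphicOn_univ.2 hM.deriv).eventually_codiscreteWithin_apply_ne_zero
      fun z _ => hM' z] with z hz1 hz2
    simp only [hWg, Pi.add_apply, Pi.neg_apply, Pi.mul_apply, Pi.inv_apply, logDeriv_apply, hG']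
    simp only [hGdef]
    field_simp
    ring
  refine ⟨_, (((hWerr.const_mul 2).add (hf.isErrorTerm_proximity_logDeriv hM hM0 hdom)).add
    (hf.isErrorTerm_proximity_logDeriv hG hG0 hGdom)).add (hf.isErrorTerm_const (c + Real.log 2)),
    fun r hr => ?_⟩
  have h1 : (d : ℝ) * proximity f⁻¹ ⊤ r = proximity (f⁻¹ ^ d) ⊤ r := by
    rw [proximity_pow_top]
    simp
  have hQi : Meromorphic (logDeriv G)⁻¹ := hG.logDeriv.inv
  have hR : Meromorphic (logDeriv g * (W * (logDeriv G)⁻¹)) := hM.logDeriv.mul (hWm.mul hQi)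
  rw [h1, proximity_congr_codiscrete hident (by linarith)]
  have h2 := proximity_add_top_le hWm hR.neg r
  have h3 := proximity_mul_top_le hM.logDeriv (hWm.mul hQi) r
  have h4 := proximity_mul_top_le hWm hQi r
  have h5 : proximity (-(logDeriv g * (W * (logDeriv G)⁻¹))) ⊤ r =
      proximity (logDeriv g * (W * (logDeriv G)⁻¹)) ⊤ r := by
    simp [proximity_top]
  -- First main theorem for `L = G'/G`: `m(r, 1/L) ≤ m(r, L) + N(r, L) - N(r, 1/L) + c`, where `m(r,
  -- L)` is an error term.
  have h6 := abs_le.1 (hc r)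
  simp only [characteristic, Pi.add_apply, logCounting_inv] at h2 h3 h4 h6
  linarith

/-- If `M[f] / φ` is constant, then the characteristic of `f` is itself an error term. -/
theorem isErrorTerm_characteristic_of_deriv_eq_zero {f a φ : ℂ → ℂ}
    (hf : TranscendentalMeromorphic f) (ha : IsSmallFunction a f) (hφ : IsSmallFunction φ f)
    (k : ℕ) (q : ℕ → ℕ) (hq : 1 ≤ q 0) (hM : Meromorphic (diffMonomial a k q f * φ⁻¹))
    (hM0 : ∀ z, meromorphicOrderAt (diffMonomial a k q f * φ⁻¹) z ≠ ⊤)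
    (hM' : SameMeromorphic (deriv (diffMonomial a k q f * φ⁻¹)) 0) :
    IsErrorTerm f (characteristic f ⊤) := by
  classical
  have ha0 := meromorphicOrderAt_ne_top_of_not_sameMeromorphic_zero ha.1 ha.2.1
  have hφ0 := meromorphicOrderAt_ne_top_of_not_sameMeromorphic_zero hφ.1 hφ.2.1
  obtain ⟨c, hc⟩ := exists_sameMeromorphic_const_of_deriv hM hM'
  have hc0 : c ≠ 0 := by
    rintro rfl
    refine hM0 0 ?_
    rw [hc.meromorphicOrderAt_eq, meromorphicOrderAt_const]
    simp
  have hord : ∀ z, meromorphicOrderAt (diffMonomial a k q f * φ⁻¹) z = 0 := fun z => by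
    rw [hc.meromorphicOrderAt_eq, meromorphicOrderAt_const]
    simp [hc0]
  set d := ∑ i ∈ Finset.range (k + 1), q i with hd
  have hd1 : 1 ≤ d := hq.trans
    (Finset.single_le_sum (fun i _ => Nat.zero_le (q i)) (Finset.mem_range.2 (Nat.succ_pos k)))
  set W := a * φ⁻¹ * ∏ i ∈ Finset.range (k + 1), (iteratedDeriv i f / f) ^ q i with hW
  have hWg : W = diffMonomial a k q f * φ⁻¹ * f⁻¹ ^ d := monomial_div_pow_eq f a φ k q
  have hWm : Meromorphic W := by
    rw [hWg]
    exact hM.mul fun z => (hf.1 z).inv.pow _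
  -- With `g = c`, the definition of `W` reads `W = c f ^ (-d)`, so `m(r, 1/f)` is an error term.
  have hident : SameMeromorphic (f⁻¹ ^ d) ((fun _ => c⁻¹) * W) := by
    filter_upwards [hc] with z hz
    rw [hWg, Pi.mul_apply, Pi.mul_apply, hz, inv_mul_cancel_left₀ hc0]
  -- Since `g` has order zero everywhere and `q 0 ≥ 1`, a zero of `f` must be cancelled by a pole of
  -- `a` or a zero of `φ`; this makes `N(r, 1/f)` an error term.
  have hdiv : (MeromorphicOn.divisor f Set.univ)⁺ ≤
      ((MeromorphicOn.divisor a Set.univ)⁺ + (MeromorphicOn.divisor a Set.univ)⁻) +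
        ((MeromorphicOn.divisor φ Set.univ)⁺ + (MeromorphicOn.divisor φ Set.univ)⁻) := by
    intro z
    simp only [Function.locallyFinsuppWithin.coe_add, Pi.add_apply,
      Function.locallyFinsuppWithin.negPart_apply,
      Function.locallyFinsuppWithin.posPart_apply]
    simp only [posPart_add_negPart]
    rw [MeromorphicOn.divisor_apply hf.1.meromorphicOn (Set.mem_univ z),
      MeromorphicOn.divisor_apply ha.1.meromorphicOn (Set.mem_univ z),
      MeromorphicOn.divisor_apply hφ.1.meromorphicOn (Set.mem_univ z)]
    have h1 := neg_abs_le (meromorphicOrderAt a z).untop₀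
    have h2 := le_abs_self (meromorphicOrderAt φ z).untop₀
    rcases le_total (meromorphicOrderAt f z).untop₀ 0 with hp | hp
    · rw [posPart_eq_zero.2 hp]
      positivity
    · rw [posPart_of_nonneg hp]
      have h3 := le_untop_meromorphicOrderAt_diffMonomial_div hf ha.1 hφ.1 ha0 hφ0 k q hp
      rw [hord z, WithTop.untop₀_zero] at h3
      have h4 : 1 * (meromorphicOrderAt f z).untop₀ ≤ q 0 * (meromorphicOrderAt f z).untop₀ :=
        mul_le_mul_of_nonneg_right (by exact_mod_cast hq) hp
      linarith
  obtain ⟨C, -, hC⟩ := exists_abs_characteristic_sub_inv_le hf.1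
  refine (((((hf.isErrorTerm_proximity_monomial ha hφ k q).add ha.2.2).add
    (hf.isErrorTerm_characteristic_inv ha.1 ha.2.2)).add hφ.2.2).add
    (hf.isErrorTerm_characteristic_inv hφ.1 hφ.2.2)).add
    (hf.isErrorTerm_const (C + Real.posLog ‖c⁻¹‖)) |>.of_le_of_one_le fun r hr => ?_
  rw [abs_of_nonneg (characteristic_nonneg hr)]
  have h1 : (d : ℝ) * proximity f⁻¹ ⊤ r = proximity (f⁻¹ ^ d) ⊤ r := by
    rw [proximity_pow_top]
    simp
  have h2 := proximity_mul_top_le (fun z => MeromorphicAt.const c⁻¹ z) hWm r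
  rw [← proximity_congr_codiscrete hident (by linarith), ← h1, Pi.add_apply, proximity_const] at h2
  have h3 : 1 * proximity f⁻¹ ⊤ r ≤ d * proximity f⁻¹ ⊤ r :=
    mul_le_mul_of_nonneg_right (by exact_mod_cast hd1) (proximity_nonneg r)
  have h4 := Function.locallyFinsuppWithin.logCounting_le hdiv hr
  simp only [map_add, Pi.add_apply, ← logCounting_zero, ← logCounting_top] at h4
  rw [← logCounting_inv (f := a), ← logCounting_inv (f := φ), ← logCounting_inv (f := f)] at h4
  have h5 := logCounting_le_characteristic (h := a) r
  have h6 := logCounting_le_characteristic (h := a⁻¹) r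
  have h7 := logCounting_le_characteristic (h := φ) r
  have h8 := logCounting_le_characteristic (h := φ⁻¹) r
  have h9 := abs_le.1 (hC r)
  have h10 : characteristic f⁻¹ ⊤ r = proximity f⁻¹ ⊤ r + logCounting f⁻¹ ⊤ r := rfl
  linarith

/-! ### Assembly of the main inequality. -/

theorem theorem2p6 (f a φ : ℂ → ℂ) (k l : ℕ) (q : ℕ → ℕ)
    (hf : TranscendentalMeromorphic f)
    (ha : IsSmallFunction a f) (hφ : IsSmallFunction φ f)
    (hk : 1 ≤ k) (hl : 1 ≤ l) (hpoles : PolesMultiplicityGe f l)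
    (hq0 : 1 + 2 / (l : ℝ) ≤ (q 0 : ℝ)) (hqk : 1 ≤ q k) :
    ∃ S : ℝ → ℝ, IsErrorTerm f S ∧
      ∀ r : ℝ, 0 < r →
        characteristic f ⊤ r ≤
          (l : ℝ) / ((l : ℝ) * (q 0 : ℝ) - (l : ℝ) - 1) *
            logCounting (fun z => (diffMonomial a k q f z - φ z)⁻¹) ⊤ r + S r := by
  have hl0 : (0 : ℝ) < l := by exact_mod_cast hl
  -- Multiplying `q₀ ≥ 1 + 2/l` by `l` gives `l q₀ ≥ l + 2`.
  have hden : 1 ≤ (l : ℝ) * (q 0 : ℝ) - (l : ℝ) - 1 := by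
    have h1 := mul_le_mul_of_nonneg_left hq0 hl0.le
    have h2 : (l : ℝ) * (1 + 2 / l) = l + 2 := by field_simp
    linarith
  have hq1 : 1 ≤ q 0 := by
    have h1 : 0 < 2 / (l : ℝ) := by positivity
    have h2 : (1 : ℝ) ≤ q 0 := by linarith
    exact_mod_cast h2
  set B := (l : ℝ) / ((l : ℝ) * (q 0 : ℝ) - (l : ℝ) - 1) with hB
  have hB0 : 0 ≤ B := div_nonneg hl0.le (by linarith)
  set N := logCounting (fun z => (diffMonomial a k q f z - φ z)⁻¹) ⊤ with hN
  suffices h : ∃ s, IsErrorTerm f s ∧ ∀ r, 1 ≤ r → characteristic f ⊤ r ≤ B * N r + s r by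
    obtain ⟨s, hs, h⟩ := h
    -- The estimates hold for `r ≥ 1`, the theorem for all `r > 0`. The positive part of the defect
    -- satisfies the inequality everywhere and is at most `|s|` for `r ≥ 1`.
    refine ⟨fun r => max 0 (characteristic f ⊤ r - B * N r),
      hs.abs.of_le_of_one_le fun r hr => ?_, fun r _ => ?_⟩
    · rw [abs_of_nonneg (le_max_left _ _)]
      refine max_le (abs_nonneg _) (le_trans ?_ (le_abs_self _))
      linarith [h r hr]
    · linarith [le_max_right 0 (characteristic f ⊤ r - B * N r)]
  have ha0 := meromorphicOrderAt_ne_top_of_not_sameMeromorphic_zero ha.1 ha.2.1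
  have hφ0 := meromorphicOrderAt_ne_top_of_not_sameMeromorphic_zero hφ.1 hφ.2.1
  have hφi0 : ∀ z, meromorphicOrderAt φ⁻¹ z ≠ ⊤ := fun z => by
    rw [meromorphicOrderAt_inv]
    simpa using hφ0 z
  have hP := meromorphic_prod_iteratedDeriv_pow hf.1 k q
  have hP0 : ∀ z, meromorphicOrderAt
      (∏ i ∈ Finset.range (k + 1), iteratedDeriv i f ^ q i) z ≠ ⊤ := fun z =>
    meromorphicOrderAt_prod_pow_ne_top _ _ (fun i _ => hf.1.iteratedDeriv i z)
      fun i _ => hf.meromorphicOrderAt_iteratedDeriv_ne_top i z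
  have haP : Meromorphic (diffMonomial a k q f) := by
    rw [diffMonomial_eq]
    exact ha.1.mul hP
  have haP0 : ∀ z, meromorphicOrderAt (diffMonomial a k q f) z ≠ ⊤ := fun z => by
    rw [diffMonomial_eq]
    exact meromorphicOrderAt_mul_ne_top (ha.1 z) (hP z) (ha0 z) (hP0 z)
  have hM : Meromorphic (diffMonomial a k q f * φ⁻¹) := haP.mul hφ.1.inv
  have hM0 : ∀ z, meromorphicOrderAt (diffMonomial a k q f * φ⁻¹) z ≠ ⊤ := fun z =>
    meromorphicOrderAt_mul_ne_top (haP z) (hφ.1 z).inv (haP0 z) (hφi0 z)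
  by_cases hconst : SameMeromorphic (deriv (diffMonomial a k q f * φ⁻¹)) 0
  · refine ⟨_, isErrorTerm_characteristic_of_deriv_eq_zero hf ha hφ k q hq1 hM hM0 hconst,
      fun r hr => ?_⟩
    have := mul_nonneg hB0 (logCounting_nonneg (f := fun z => (diffMonomial a k q f z - φ z)⁻¹)
      (e := ⊤) hr)
    linarith
  have hM' := meromorphicOrderAt_ne_top_of_not_sameMeromorphic_zero hM.deriv hconst
  have hφi := hf.isErrorTerm_characteristic_inv hφ.1 hφ.2.2
  have hai := hf.isErrorTerm_characteristic_inv ha.1 ha.2.2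
  have hdom : IsDominatedTerm f (characteristic (diffMonomial a k q f * φ⁻¹) ⊤) := by
    have h1 := IsDominatedTerm.prod_pow (Finset.range (k + 1)) q hf
      (fun i _ => hf.1.iteratedDeriv i)
      (fun i _ => hf.meromorphicOrderAt_iteratedDeriv_ne_top i)
      (fun i _ => hf.isDominatedTerm_iteratedDeriv i)
    refine ((ha.2.2.isDominatedTerm.add h1).add hφi.isDominatedTerm).of_le_of_one_le fun r hr => ?_
    have h2 := characteristic_mul_top_le hr haP haP0 hφ.1.inv hφi0
    have h3 := characteristic_mul_top_le hr ha.1 ha0 hP hP0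
    rw [← diffMonomial_eq] at h3
    simp only [Pi.add_apply] at h2 h3
    linarith
  obtain ⟨s, hs, hprox⟩ := exists_proximity_inv_le hf ha hφ k q hM hM0 hM' hdom
  obtain ⟨c, hc0, hc⟩ := exists_abs_characteristic_sub_inv_le hf.1
  set d := ∑ i ∈ Finset.range (k + 1), q i with hd
  have hdq : (q 0 : ℝ) ≤ d := by
    exact_mod_cast Finset.single_le_sum (fun i _ => Nat.zero_le (q i))
      (Finset.mem_range.2 (Nat.succ_pos k))
  -- The constant is `d * c` from `T(r, f) ≤ T(r, 1/f) + c` taken `d` times, plus `(d + 1) * c` from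
  -- `N(r, 1/f) ≤ T(r, f) + c` taken `d - q₀ + 1` times.
  refine ⟨_, (((((hs.add (hf.isErrorTerm_const (2 * d * c + c))).add ha.2.2).add hai).add
    hφ.2.2).add hφi).const_mul B, fun r hr => ?_⟩
  have h1 := logCounting_logDeriv_inequality hf ha.1 hφ.1 ha0 hφ0 k q hl hpoles hM hM0 hM' hr
  have h2 := hprox r hr
  have h3 := abs_le.1 (hc r)
  have h4 := logCounting_le_characteristic (h := f) r
  have h5 := logCounting_le_characteristic (h := f⁻¹) r
  rw [← logCounting_inv (f := a), ← logCounting_inv (f := φ), ← logCounting_inv (f := f)] at h1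
  have h6 := logCounting_le_characteristic (h := a) r
  have h7 := logCounting_le_characteristic (h := a⁻¹) r
  have h8 := logCounting_le_characteristic (h := φ) r
  have h9 := logCounting_le_characteristic (h := φ⁻¹) r
  have h10 : characteristic f⁻¹ ⊤ r = proximity f⁻¹ ⊤ r + logCounting f⁻¹ ⊤ r := rfl
  set T := characteristic f ⊤ r
  set Q1 := logCounting (logDeriv fun w => (diffMonomial a k q f * φ⁻¹) w - 1) ⊤ r
  set Q0 := logCounting (logDeriv fun w => (diffMonomial a k q f * φ⁻¹) w - 1) 0 r
  set n := logCounting f⁻¹ ⊤ r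
  set X := s r + (2 * d * c + c) + characteristic a ⊤ r + characteristic a⁻¹ ⊤ r +
    characteristic φ ⊤ r + characteristic φ⁻¹ ⊤ r with hX
  have e1 : d * T ≤ d * proximity f⁻¹ ⊤ r + d * n + d * c := by
    have : T ≤ proximity f⁻¹ ⊤ r + n + c := by linarith
    nlinarith [mul_le_mul_of_nonneg_left this (Nat.cast_nonneg (α := ℝ) d)]
  -- Of the `d` copies of `N(r, 1/f)`, `q₀ - 1` are kept for the pointwise comparison; the other `d
  -- - q₀ + 1` are bounded by `T(r, f)` and absorbed on the left, which leaves `(q₀ - 1) T(r, f)`.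
  have e2 : ((d : ℝ) - q 0 + 1) * n ≤ (d - q 0 + 1) * (T + c) :=
    mul_le_mul_of_nonneg_left (by linarith) (by linarith)
  have e3 : ((d : ℝ) - q 0 + 1) * c ≤ (d + 1) * c :=
    mul_le_mul_of_nonneg_right (by linarith [(Nat.cast_nonneg (α := ℝ) (q 0))]) hc0
  have e4 : ((q 0 : ℝ) - 1) * T ≤ s r + (2 * d * c + c) + (((q 0 : ℝ) - 1) * n + (Q1 - Q0)) := by
    nlinarith
  have e5 : l * (((q 0 : ℝ) - 1) * T) ≤ T + l * (N r + X) := by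
    have := mul_le_mul_of_nonneg_left e4 hl0.le
    have e6 : (l : ℝ) * (N r + (logCounting a⁻¹ ⊤ r + logCounting a ⊤ r) +
        (logCounting φ⁻¹ ⊤ r + logCounting φ ⊤ r)) ≤
        l * (N r + (characteristic a⁻¹ ⊤ r + characteristic a ⊤ r) +
          (characteristic φ⁻¹ ⊤ r + characteristic φ ⊤ r)) := by gcongr
    rw [hX]
    nlinarith
  rw [← mul_add, hB, div_mul_eq_mul_div, le_div_iff₀ (by linarith)]
  linarith
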